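/- Let $p$ be a prime. **Proof system.** Formulas are built from variables with $\neg$, $\bigvee$ of unbounded arity and $MOD_{p,i}$ of unbounded arity ($i\in\mathbb Z/p$; the intended meaning of $MOD_{p,i}(y_1,\dots,y_k)$ is $\sum_j y_j\equiv i \pmod p$); arity $0$ is allowed. $\bigwedge_i\varphi_i$ abbreviates $\neg\bigvee_i\neg\varphi_i$, and $\varphi\equiv\psi$ abbreviates $(\neg\varphi\vee\psi)\wedge(\neg\psi\vee\varphi)$. The depth of a formula is the maximal number of alternations of connectives on a branch: adjacent negations count once, adjacent disjunctions count once, every $MOD$ connective counts, and a variable has depth $0$. $LK(MOD_p)$ is the sequent calculus with initial sequents $\varphi\to\varphi$, the structural rules (weakening, contraction, exchange), cut, the left and right $\neg$-rules, the rule $\bigvee$:left (from $\varphi_i,\Gamma\to\Delta$ for all $i\le t$ infer $\bigvee_{i\le t}\varphi_i,\Gamma\to\Delta$), the rule $\bigvee$:right (from $\Gamma\to\Delta,\varphi_j$ with $j\le t$ infer $\Gamma\to\Delta,\bigvee_{i\le t}\varphi_i$), and the axioms $MOD_{p,0}(\emptyset)$; $\neg MOD_{p,i}(\emptyset)$ for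 $i\ne 0$; and $MOD_{p,i}(\Gamma,\varphi)\equiv[(MOD_{p,i}(\Gamma)\wedge\neg\varphi)\vee(MOD_{p,i-1}(\Gamma)\wedge\varphi)]$. $LK_d(MOD_p)$ is the subsystem that uses only formulas of depth at most $d$. A refutation of a set of formulas is a (dag-like) proof of the empty sequent in which also $\to\varphi$, for $\varphi$ in the set, may be used as initial sequents. Its size is the total number of symbols. For a polynomial $f=\sum_{a}c_a x_a$ over $\mathbb F_p$ ($x_a$ distinct monomials, $c_a\in\{1,\dots,p-1\}$), the equation $f=0$ is identified with the formula $MOD_{p,0}(\psi_1,\dots,\psi_k)$, $k=\sum_a c_a$, where the $\psi_j$ are the conjunctions of the variables of the monomials $x_a$, each one repeated $c_a$ times. **Systems.** Let $r:\mathbb N\to\mathbb N$ satisfy $r(n)\ge(\log n)^{\omega(1)}$. For $n\ge1$ let $\mathcal F_n$ be a set of polynomials over $\mathbb F_p$ in the finite set of variables $Var(\mathcal F_n)$ such that (1) the degrees of all $f\in\mathcal F_n$ are bounded by a constant independent of $n$; (2) $|\mathcal F_n|$ and $|Var(\mathcal F_n)|$ are $n^{O(1)}$; (3) $x^2-x\in\mathcal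 F_n$ for all $x\in Var(\mathcal F_n)$, and the system $f=0$, $f\in\mathcal F_n$, has no solution in $\mathbb F_p$. **Search trees.** Let $S_{\mathcal F_n,e}$ be the $\mathbb F_p$-vector space of multilinear polynomials of degree at most $e$ in the variables $Var(\mathcal F_n)$, where polynomials are identified with their multilinear representatives modulo all $x^2-x$. An $S_{\mathcal F_n,e}$-search tree is a $p$-ary tree whose inner nodes are labelled by elements $g\in S_{\mathcal F_n,e}$, the $p$ edges leaving such a node being labelled $g=0,\dots,g=p-1$. A map $B:S_{\mathcal F_n,e}\to\mathbb F_p$ determines the path that follows the edges $g=B(g)$, and $T(B)$ denotes the label of the leaf reached. Let $ER_{\mathcal F_n,e}$ be the set of the following labels, each given with the condition under which it is an error for $B$ (where all polynomials at which $B$ is evaluated must lie in $S_{\mathcal F_n,e}$): $(B1,c)$, $c\in\mathbb F_p$: $B(c)\ne c$; $(B1,x)$, $x$ a variable: $B(x)\notin\{0,1\}$; $(B2,f,g)$: $B(f)+B(g)\ne B(f+g)$; $(B3,x_a,x_b)$, $x_a,x_b$ monomials: $B(x_a)B(x_b)\ne B(x_a\cdot x_b)$; $(B4,f)$, $f\in\mathcal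 F_n$: $B(f)\ne0$. **Theorem 6.2.** For every $d\ge2$ there are $\epsilon_d>0$, $n_d\ge1$ and $\delta>0$ such that for all $n\ge n_d$, all non-empty sets $\Omega$ of maps from $S_{\mathcal F_n,r(n)}$ to $\mathbb F_p$, and all $0<\epsilon\le\epsilon_d$ the following implication holds. If for every $S_{\mathcal F_n,r(n)}$-search tree $T$ of depth at most $r(n)$ with leaves labelled by elements of $ER_{\mathcal F_n,r(n)}$, $$\mathrm{Prob}_{B\in\Omega}[\,T(B)\text{ is not an error for }B\,]>1-2^{-r(n)^{\epsilon}}$$ ($B$ uniformly distributed in $\Omega$), then every $LK_d(MOD_p)$ refutation of the set of formulas $f=0$, $f\in\mathcal F_n$, has size at least $2^{\delta\, r(n)^{\epsilon}}$. -/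

import Mathlib

open Filter

namespace ModFrege

universe u

/-! ### Formulas -/

/-- Formulas over the variables `V` with the connectives `¬`, unbounded-arity `⋁`, and
unbounded-arity `MOD_{p,i}` for `i` modulo `p` (the intended meaning of `MOD_{p,i}(y₁,…,y_k)`
is `∑ y_j ≡ i (mod p)`).  The arities may be `0`. -/
inductive Formula (p : ℕ) (V : Type u) : Type u
  | var : V → Formula p V
  | neg : Formula p V → Formula p V
  | or : List (Formula p V) → Formula p V
  | mod : ZMod p → List (Formula p V) → Formula p V

namespace Formula

variable {p : ℕ} {V : Type u}

/-- The outermost connective of the formula is `¬`. -/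
def IsNeg : Formula p V → Bool
  | neg _ => true
  | _ => false

/-- The outermost connective of the formula is `⋁`. -/
def IsOr : Formula p V → Bool
  | or _ => true
  | _ => false

mutual
/-- The depth: the maximal number of blocks of equal connectives on a branch of the formula.
Adjacent negations form one block and adjacent disjunctions form one block, while every
`MOD` connective counts.  So variables have depth `0`, `⋁ⱼ pⱼ` has depth `1` and
`¬p ∨ ¬q` has depth `2`. -/
def depth : Formula p V → ℕ
  | var _ => 0
  | neg φ => if φ.IsNeg then depth φ else depth φ + 1
  | or φs => max 1 (depthUnderOr φs)
  | mod _ φs => depthMax φs + 1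
/-- The maximum over the disjuncts of their contribution to the depth of the disjunction. -/
def depthUnderOr : List (Formula p V) → ℕ
  | [] => 0
  | φ :: φs => max (if φ.IsOr then depth φ else depth φ + 1) (depthUnderOr φs)
/-- The maximal depth of a formula in the list. -/
def depthMax : List (Formula p V) → ℕ
  | [] => 0
  | φ :: φs => max (depth φ) (depthMax φs)
end

mutual
/-- The number of symbols (variables and connectives) of a formula. -/
def size : Formula p V → ℕ
  | var _ => 1
  | neg φ => size φ + 1
  | or φs => sizeSum φs + 1
  | mod _ φs => sizeSum φs + 1
/-- The total number of symbols of the formulas in a list. -/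
def sizeSum : List (Formula p V) → ℕ
  | [] => 0
  | φ :: φs => size φ + sizeSum φs
end

/-- Conjunction, as an abbreviation `⋀ φᵢ := ¬ ⋁ ¬ φᵢ`. -/
def and (φs : List (Formula p V)) : Formula p V := neg (or (φs.map neg))

/-- Equivalence, as an abbreviation. -/
def iff (φ ψ : Formula p V) : Formula p V := and [or [neg φ, ψ], or [neg ψ, φ]]

end Formula

/-- The `MOD_p`-axioms. -/
inductive IsModAxiom {p : ℕ} {V : Type u} : Formula p V → Prop
  | empty_zero : IsModAxiom (.mod 0 [])
  | empty_ne (i : ZMod p) (hi : i ≠ 0) : IsModAxiom (.neg (.mod i []))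
  | step (i : ZMod p) (Γ : List (Formula p V)) (φ : Formula p V) :
      IsModAxiom (.iff (.mod i (Γ ++ [φ]))
        (.or [.and [.mod i Γ, .neg φ], .and [.mod (i - 1) Γ, φ]]))

/-! ### The sequent calculus `LK(MOD_p)` -/

/-- A sequent `Γ → Δ`. -/
structure Sequent (p : ℕ) (V : Type u) where
  /-- the antecedent `Γ` -/
  ante : List (Formula p V)
  /-- the succedent `Δ` -/
  succ : List (Formula p V)

/-- `Infer A P S`: the sequent `S` is an initial sequent, or it follows by one rule from
sequents satisfying `P`.  The members of `A` are non-logical axioms. -/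
inductive Infer {p : ℕ} {V : Type u} (A : Set (Formula p V)) (P : Sequent p V → Prop) :
    Sequent p V → Prop
  | init (φ : Formula p V) : Infer A P ⟨[φ], [φ]⟩
  | modAxiom (φ : Formula p V) : IsModAxiom φ → Infer A P ⟨[], [φ]⟩
  | nonlogical (φ : Formula p V) : φ ∈ A → Infer A P ⟨[], [φ]⟩
  | weakLeft (φ : Formula p V) (Γ Δ : List (Formula p V)) :
      P ⟨Γ, Δ⟩ → Infer A P ⟨φ :: Γ, Δ⟩
  | weakRight (φ : Formula p V) (Γ Δ : List (Formula p V)) :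
      P ⟨Γ, Δ⟩ → Infer A P ⟨Γ, φ :: Δ⟩
  | contrLeft (φ : Formula p V) (Γ Δ : List (Formula p V)) :
      P ⟨φ :: φ :: Γ, Δ⟩ → Infer A P ⟨φ :: Γ, Δ⟩
  | contrRight (φ : Formula p V) (Γ Δ : List (Formula p V)) :
      P ⟨Γ, φ :: φ :: Δ⟩ → Infer A P ⟨Γ, φ :: Δ⟩
  | exchange (Γ Γ' Δ Δ' : List (Formula p V)) : Γ.Perm Γ' → Δ.Perm Δ' →
      P ⟨Γ, Δ⟩ → Infer A P ⟨Γ', Δ'⟩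
  | cut (φ : Formula p V) (Γ Δ : List (Formula p V)) :
      P ⟨Γ, φ :: Δ⟩ → P ⟨φ :: Γ, Δ⟩ → Infer A P ⟨Γ, Δ⟩
  | negLeft (φ : Formula p V) (Γ Δ : List (Formula p V)) :
      P ⟨Γ, φ :: Δ⟩ → Infer A P ⟨.neg φ :: Γ, Δ⟩
  | negRight (φ : Formula p V) (Γ Δ : List (Formula p V)) :
      P ⟨φ :: Γ, Δ⟩ → Infer A P ⟨Γ, .neg φ :: Δ⟩
  | orLeft (φs Γ Δ : List (Formula p V)) :
      (∀ φ ∈ φs, P ⟨φ :: Γ, Δ⟩) → Infer A P ⟨.or φs :: Γ, Δ⟩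
  | orRight (φs : List (Formula p V)) (φ : Formula p V) (Γ Δ : List (Formula p V)) :
      φ ∈ φs → P ⟨Γ, φ :: Δ⟩ → Infer A P ⟨Γ, .or φs :: Δ⟩

/-- `π` is an `LK_d(MOD_p)` refutation of the set of formulas `A`: a sequence of sequents, each
initial or inferred from earlier ones, ending with the empty sequent, in which every formula has
depth at most `d`. -/
structure IsRefutation {p : ℕ} {V : Type u} (d : ℕ) (A : Set (Formula p V))
    (π : List (Sequent p V)) : Prop where
  infer : ∀ k (hk : k < π.length), Infer A (fun S => S ∈ π.take k) π[k]
  last : π.getLast? = some ⟨[], []⟩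
  depth_le : ∀ S ∈ π, ∀ φ ∈ S.ante ++ S.succ, φ.depth ≤ d

/-- The number of symbols of a sequence of sequents, where each sequent contributes its arrow
and the symbols of its formulas. -/
def proofSize {p : ℕ} {V : Type u} (π : List (Sequent p V)) : ℕ :=
  (π.map fun S => 1 + Formula.sizeSum S.ante + Formula.sizeSum S.succ).sum

/-! ### Polynomial equations as formulas -/

/-- The formula expressing `f = 0` on Boolean variables: `MOD_{p,0}` of the list that contains,
for every monomial of `f`, the conjunction of its variables, repeated `c` times where
`c ∈ {1, …, p - 1}` is the coefficient. -/
noncomputable def eqFormula {p : ℕ} {V : Type u} (f : MvPolynomial V (ZMod p)) : Formula p V :=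
  .mod 0 (f.support.toList.flatMap fun m =>
    List.replicate (f.coeff m).val (.and (m.support.toList.map .var)))

/-! ### Low-degree multilinear polynomials -/

/-- The `𝔽_p`-vector space of multilinear polynomials of degree at most `e`. -/
noncomputable def LowDeg (p : ℕ) (V : Type u) (e : ℕ) :
    Submodule (ZMod p) (MvPolynomial V (ZMod p)) :=
  MvPolynomial.restrictDegree V (ZMod p) 1 ⊓ MvPolynomial.restrictTotalDegree V (ZMod p) e

/-- The multilinear monomial `x_a`. -/
noncomputable def mono (p : ℕ) {V : Type u} (a : Finset V) : MvPolynomial V (ZMod p) :=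
  ∏ i ∈ a, MvPolynomial.X i

/-- The multilinear polynomial that is congruent to `f` modulo the ideal generated by the
polynomials `x ^ 2 - x`: every power `x ^ k` with `k ≥ 1` is replaced by `x`. -/
noncomputable def multilin {p : ℕ} {V : Type u} (f : MvPolynomial V (ZMod p)) :
    MvPolynomial V (ZMod p) :=
  ∑ m ∈ f.support, f.coeff m • mono p m.support

/-! ### Errors and search trees -/

/-- Names of possible rule violations by a map on `LowDeg p V e`. -/
inductive ErrorLabel (p : ℕ) {V : Type u} (F : Finset (MvPolynomial V (ZMod p))) (e : ℕ) : Type u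
  | const (c : ZMod p)
  | var (x : V)
  | add (f g : LowDeg p V e)
  | mul (a b : Finset V)
  | eqn (f : MvPolynomial V (ZMod p)) (hf : f ∈ F)

open scoped Classical in
/-- The label is an error for `B`, that is, `B` violates the named instance of the named rule:
constants get their value; variables get `0` or `1`; sums are respected; products `x_a x_b` of
monomials are respected (the product, reduced modulo `x ^ 2 - x`, is `x_{a ∪ b}`); the
polynomials of the system get value `0`.  All polynomials involved have to lie in the domain
of `B`. -/
def ErrorLabel.IsError {p : ℕ} {V : Type u} {F : Finset (MvPolynomial V (ZMod p))} {e : ℕ}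
    (B : LowDeg p V e → ZMod p) : ErrorLabel p F e → Prop
  | const c => ∃ u : LowDeg p V e, (u : MvPolynomial V (ZMod p)) = MvPolynomial.C c ∧ B u ≠ c
  | var x => ∃ u : LowDeg p V e, (u : MvPolynomial V (ZMod p)) = MvPolynomial.X x ∧
      B u ≠ 0 ∧ B u ≠ 1
  | add f g => B f + B g ≠ B (f + g)
  | mul a b => ∃ u v w : LowDeg p V e, (u : MvPolynomial V (ZMod p)) = mono p a ∧
      (v : MvPolynomial V (ZMod p)) = mono p b ∧
      (w : MvPolynomial V (ZMod p)) = mono p (a ∪ b) ∧ B u * B v ≠ B w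
  | eqn f _ => ∃ u : LowDeg p V e, (u : MvPolynomial V (ZMod p)) = multilin f ∧ B u ≠ 0

/-- `p`-ary search trees: inner nodes are labelled by elements of `Q`, the edges leaving an inner
node by the elements of `ZMod p`, the leaves by elements of `X`. -/
inductive SearchTree (p : ℕ) (Q X : Type u) : Type u
  | leaf : X → SearchTree p Q X
  | node : Q → (ZMod p → SearchTree p Q X) → SearchTree p Q X

/-- All branches of the tree have at most `k` edges. -/
def SearchTree.DepthLE {p : ℕ} {Q X : Type u} : SearchTree p Q X → ℕ → Prop
  | leaf _, _ => True
  | node _ _, 0 => False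
  | node _ t, k + 1 => ∀ c, (t c).DepthLE k

/-- The label of the leaf at the end of the path determined by `B`. -/
def SearchTree.eval {p : ℕ} {Q X : Type u} (B : Q → ZMod p) : SearchTree p Q X → X
  | leaf x => x
  | node g t => (t (B g)).eval B

open scoped Classical in
/-- The probability, for `B` uniformly distributed in `Ω`, that the output of `T` on `B` is not an
error for `B`. -/
noncomputable def probNoError {p : ℕ} {V : Type u} {F : Finset (MvPolynomial V (ZMod p))} {e : ℕ}
    (Ω : Finset (LowDeg p V e → ZMod p)) (T : SearchTree p (LowDeg p V e) (ErrorLabel p F e)) :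
    ℝ :=
  ((Ω.filter fun B => ¬ (T.eval B).IsError B).card : ℝ) / (Ω.card : ℝ)

end ModFrege

namespace ModFrege
universe u

-- A short refutation would give one shallow search tree that finds an error for at least half of
-- the maps in `Ω`. By hypothesis every tree of depth `r n` finds an error with probability below `2
-- ^ (-(r n) ^ ε) ≤ 1 / 2`, a contradiction.
--
-- Formulas become low-degree polynomials as in Razborov and Smolensky (`hat`): negation is `1 - f`,
-- `MOD` is expressed by Fermat's little theorem, and a block of disjunctions becomes `1 - ∏ (1 - Lᵢ
-- ^ (p - 1))` for `h` random linear combinations `Lᵢ` of its members. A formula is true under `B`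
-- if `B` is nonzero at its polynomial. Since `B` is an arbitrary map, no law of algebra or logic
-- may be assumed for it; instead each law is proved in the form "if it fails for `B`, few queries
-- exhibit a violated rule" (`Detectable`). A deduction then becomes a search tree: if its
-- conclusion fails, one of the laws it rests on fails, and `Detectable.or` combines their trees at
-- the sum of the costs. Failures inside long sums are located by binary search (`Detectable.sum`),
-- so size enters only through its logarithm.
--
-- The one law that may fail without any error is that a true disjunct makes a disjunction true. For
-- a fixed `B`, random coefficients hide a given true disjunct with probability at most `p ^ (-h)`
-- (`card_hides_mul_le`). As `B` need not be linear, hiding is taken to include that `B` behaves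
-- linearly at the few sums used in this count; otherwise a detectable error is at hand. A union
-- bound and averaging give one choice of coefficients that is good for half of `Ω`
-- (`exists_coeffs`).
--
-- For good coefficients, `prefixFormula π i` says that one of the first `i` sequents is false. It
-- is an empty disjunction for `i = 0`, and at the end it has to be true because the empty sequent
-- is false. Binary search finds a place where the truth value changes: a false sequent inferred
-- from true ones. Local soundness (`Budget.detectable_infer`) then yields an error
-- (`Budget.detectable_good`). All costs are polynomial in `H`, where `2 ^ H` bounds the proof size,
-- and `H` is a small enough power of `r n`.

theorem SearchTree.DepthLE.mono {p : ℕ} {Q X : Type u} {T : SearchTree p Q X} :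
    ∀ {k l : ℕ}, T.DepthLE k → k ≤ l → T.DepthLE l := by
  induction T with
  | leaf x => intro k l _ _; simp [SearchTree.DepthLE]
  | node q t ih =>
    intro k l h hkl
    cases k with
    | zero => simp [SearchTree.DepthLE] at h
    | succ k =>
      obtain ⟨l, rfl⟩ : ∃ l', l = l' + 1 := ⟨l - 1, by omega⟩
      simp only [SearchTree.DepthLE] at h ⊢
      exact fun c => ih c (h c) (by omega)

/-! ### Classes of maps for which an error is found by few queries -/

section Detectable

variable {p : ℕ} {V : Type u} {F : Finset (MvPolynomial V (ZMod p))} {e : ℕ}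

variable (F) in
/-- One search tree of depth at most `k` finds an error for every `B` satisfying `P`. -/
def Detectable (k : ℕ) (P : (LowDeg p V e → ZMod p) → Prop) : Prop :=
  ∃ T : SearchTree p (LowDeg p V e) (ErrorLabel p F e),
    T.DepthLE k ∧ ∀ B, P B → (T.eval B).IsError B

variable {k l : ℕ} {P P' : (LowDeg p V e → ZMod p) → Prop}

theorem Detectable.mono (h : Detectable F k P) (hP : ∀ B, P' B → P B) (hk : k ≤ l) :
    Detectable F l P' := by
  obtain ⟨T, hT, h⟩ := h
  exact ⟨T, hT.mono hk, fun B hB => h B (hP B hB)⟩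

theorem Detectable.imp (h : Detectable F k P) (hP : ∀ B, P' B → P B) : Detectable F k P' :=
  h.mono hP le_rfl

theorem Detectable.le (h : Detectable F k P) (hk : k ≤ l) : Detectable F l P :=
  h.mono (fun _ => id) hk

theorem detectable_of_isError (x : ErrorLabel p F e) (h : ∀ B, P B → x.IsError B) :
    Detectable F k P :=
  ⟨.leaf x, by simp [SearchTree.DepthLE], by simpa [SearchTree.eval] using h⟩

theorem detectable_of_false (h : ∀ B, ¬ P B) : Detectable F k P :=
  detectable_of_isError (.const 0) fun B hB => (h B hB).elim

theorem Detectable.query (g : LowDeg p V e)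
    (h : ∀ c, Detectable F k fun B => P B ∧ B g = c) : Detectable F (k + 1) P := by
  choose T hT hE using h
  refine ⟨.node g T, by simpa [SearchTree.DepthLE] using hT, fun B hB => ?_⟩
  simpa [SearchTree.eval] using hE (B g) B ⟨hB, rfl⟩

/-- Recording the answers as the values of a single map `B₀` allows later steps to decide, without
further queries, whether a label is an error. -/
theorem Detectable.query_list (gs : List (LowDeg p V e)) (P : (LowDeg p V e → ZMod p) → Prop)
    (h : ∀ B₀ : LowDeg p V e → ZMod p, Detectable F k fun B => P B ∧ ∀ g ∈ gs, B g = B₀ g) :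
    Detectable F (k + gs.length) P := by
  classical
  induction gs generalizing P with
  | nil => exact (h fun _ => 0).imp (by simp)
  | cons g gs ih =>
    rw [List.length_cons, ← add_assoc]
    refine Detectable.query g fun c => ih _ fun B₀ => ?_
    -- The answer `c` may clash with `B₀`, for instance when `g` occurs again in `gs`. Then no map
    -- follows this branch; otherwise a map that does replaces `B₀`.
    by_cases hg : ∃ B, P B ∧ B g = c ∧ ∀ g ∈ gs, B g = B₀ g
    · obtain ⟨B₁, -, h1, h2⟩ := hg
      refine (h B₁).imp fun B hB => ⟨hB.1.1, ?_⟩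
      simp only [List.mem_cons, forall_eq_or_imp]
      exact ⟨hB.1.2.trans h1.symm, fun g hg => (hB.2 g hg).trans (h2 g hg).symm⟩
    · exact detectable_of_false fun B hB => hg ⟨B, hB.1.1, hB.1.2, hB.2⟩

/-- Whether a label is an error depends on the values at three polynomials only. -/
theorem ErrorLabel.exists_queries (x : ErrorLabel p F e) :
    ∃ gs : List (LowDeg p V e), gs.length ≤ 3 ∧
      ∀ B B', (∀ g ∈ gs, B g = B' g) → x.IsError B → x.IsError B' := by
  cases x with
  | const c =>
    by_cases h : ∃ u : LowDeg p V e, (u : MvPolynomial V (ZMod p)) = MvPolynomial.C c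
    · obtain ⟨u, hu⟩ := h
      refine ⟨[u], by simp, fun B B' hB => ?_⟩
      rintro ⟨w, hw, h⟩
      obtain rfl : u = w := Subtype.ext (hu.trans hw.symm)
      exact ⟨u, hu, by rwa [← hB u (by simp)]⟩
    · exact ⟨[], by simp, fun B B' _ ⟨u, hu, _⟩ => (h ⟨u, hu⟩).elim⟩
  | var c =>
    by_cases h : ∃ u : LowDeg p V e, (u : MvPolynomial V (ZMod p)) = MvPolynomial.X c
    · obtain ⟨u, hu⟩ := h
      refine ⟨[u], by simp, fun B B' hB => ?_⟩
      rintro ⟨w, hw, h⟩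
      obtain rfl : u = w := Subtype.ext (hu.trans hw.symm)
      exact ⟨u, hu, by rwa [← hB u (by simp)]⟩
    · exact ⟨[], by simp, fun B B' _ ⟨u, hu, _⟩ => (h ⟨u, hu⟩).elim⟩
  | add f g =>
    refine ⟨[f, g, f + g], by simp, fun B B' hB h => ?_⟩
    simp only [IsError] at h ⊢
    rwa [← hB f (by simp), ← hB g (by simp), ← hB (f + g) (by simp)]
  | mul a b =>
    by_cases h : ∃ u v w : LowDeg p V e, (u : MvPolynomial V (ZMod p)) = mono p a ∧
      (v : MvPolynomial V (ZMod p)) = mono p b ∧ (w : MvPolynomial V (ZMod p)) = mono p (a ∪ b)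
    · obtain ⟨u, v, w, hu, hv, hw⟩ := h
      refine ⟨[u, v, w], by simp, fun B B' hB => ?_⟩
      rintro ⟨u', v', w', hu', hv', hw', h⟩
      obtain rfl : u = u' := Subtype.ext (hu.trans hu'.symm)
      obtain rfl : v = v' := Subtype.ext (hv.trans hv'.symm)
      obtain rfl : w = w' := Subtype.ext (hw.trans hw'.symm)
      refine ⟨u, v, w, hu, hv, hw, ?_⟩
      rwa [← hB u (by simp), ← hB v (by simp), ← hB w (by simp)]
    · exact ⟨[], by simp, fun B B' _ ⟨u, v, w, hu, hv, hw, _⟩ => (h ⟨u, v, w, hu, hv, hw⟩).elim⟩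
  | eqn f hf =>
    by_cases h : ∃ u : LowDeg p V e, (u : MvPolynomial V (ZMod p)) = multilin f
    · obtain ⟨u, hu⟩ := h
      refine ⟨[u], by simp, fun B B' hB => ?_⟩
      rintro ⟨w, hw, h⟩
      obtain rfl : u = w := Subtype.ext (hu.trans hw.symm)
      exact ⟨u, hu, by rwa [← hB u (by simp)]⟩
    · exact ⟨[], by simp, fun B B' _ ⟨u, hu, _⟩ => (h ⟨u, hu⟩).elim⟩

/-- Grafting: below a leaf labelled `x`, the continuation may use that `T` returned `x`. -/
theorem Detectable.bind (T : SearchTree p (LowDeg p V e) (ErrorLabel p F e)) :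
    ∀ (k : ℕ) (P : (LowDeg p V e → ZMod p) → Prop), T.DepthLE k →
      (∀ x, Detectable F l fun B => P B ∧ T.eval B = x) → Detectable F (l + k) P := by
  induction T with
  | leaf x => exact fun k P _ h => (h x).mono (by simp [SearchTree.eval]) (by omega)
  | node q t ih =>
    intro k P hT h
    cases k with
    | zero => simp [SearchTree.DepthLE] at hT
    | succ k =>
      simp only [SearchTree.DepthLE] at hT
      rw [← add_assoc]
      refine Detectable.query q fun c => ih c k _ (hT c) fun x => (h x).imp ?_
      rintro B ⟨⟨h1, rfl⟩, h2⟩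
      exact ⟨h1, by simpa [SearchTree.eval] using h2⟩

/-- The label found by the first tree is verified by three queries; if it is not an error, the
second tree is used. -/
theorem Detectable.or (h : Detectable F k P) (h' : Detectable F l P') :
    Detectable F (k + l + 3) fun B => P B ∨ P' B := by
  obtain ⟨T, hT, hE⟩ := h
  refine (Detectable.bind (l := l + 3) T k _ hT fun x => ?_).le (by omega)
  obtain ⟨gs, hlen, hgs⟩ := x.exists_queries
  refine (Detectable.query_list (k := l) gs _ fun B₀ => ?_).le (Nat.add_le_add_left hlen l)
  by_cases hx : x.IsError B₀
  · exact detectable_of_isError x fun B hB => hgs B₀ B (fun g hg => (hB.2 g hg).symm) hx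
  · refine h'.imp fun B hB => hB.1.1.resolve_left fun hP => hx ?_
    exact hgs B B₀ hB.2 (hB.1.2 ▸ hE B hP)

theorem Detectable.cases (h : Detectable F k P) (h' : Detectable F l P')
    {P₀ : (LowDeg p V e → ZMod p) → Prop} (h0 : ∀ B, P₀ B → P B ∨ P' B) :
    Detectable F (k + l + 3) P₀ := (h.or h').imp h0

theorem Detectable.exists_lt (n : ℕ) {P : ℕ → (LowDeg p V e → ZMod p) → Prop}
    (h : ∀ i < n, Detectable F k (P i)) : Detectable F (n * (k + 3)) fun B => ∃ i < n, P i B := by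
  induction n with
  | zero => exact detectable_of_false (by simp)
  | succ n ih =>
    refine ((ih fun i hi => h i (by omega)).cases (h n (by omega)) fun B hB => ?_).le
      (by ring_nf; omega)
    obtain ⟨i, hi, hB⟩ := hB
    rcases Nat.lt_succ_iff_lt_or_eq.1 hi with hi | rfl
    · exact .inl ⟨i, hi, hB⟩
    · exact .inr hB

theorem Detectable.exists_mem {ι : Type*} (s : List ι) {P : ι → (LowDeg p V e → ZMod p) → Prop}
    (h : ∀ i ∈ s, Detectable F k (P i)) :
    Detectable F (s.length * (k + 3)) fun B => ∃ i ∈ s, P i B := by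
  refine (Detectable.exists_lt s.length (k := k) (P := fun i B => ∃ h : i < s.length, P s[i] B)
    fun i hi => (h s[i] (by simp)).imp fun B hB => hB.2).imp fun B hB => ?_
  obtain ⟨x, hx, hB⟩ := hB
  obtain ⟨i, hi, rfl⟩ := List.getElem_of_mem hx
  exact ⟨i, hi, hi, hB⟩

/-- Asking the queries in turn until one has a value outside of `Z`. -/
theorem Detectable.exists_query (n : ℕ) (g : ℕ → LowDeg p V e) (Z : Set (ZMod p))
    (h : ∀ i < n, Detectable F k fun B => P B ∧ B (g i) ∉ Z) :
    Detectable F (k + n) fun B => P B ∧ ∃ i < n, B (g i) ∉ Z := by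
  induction n with
  | zero => exact detectable_of_false (by simp)
  | succ n ih =>
    rw [← add_assoc]
    refine Detectable.query (g n) fun c => ?_
    by_cases hc : c ∈ Z
    · refine (ih fun i hi => h i (by omega)).imp ?_
      rintro B ⟨⟨h1, i, hi, h2⟩, rfl⟩
      rcases Nat.lt_succ_iff_lt_or_eq.1 hi with hi | rfl
      · exact ⟨h1, i, hi, h2⟩
      · exact (h2 hc).elim
    · refine (h n (by omega)).mono ?_ (by omega)
      rintro B ⟨⟨h1, -⟩, rfl⟩
      exact ⟨h1, hc⟩

/-- Binary search for a change of truth value in a sequence of queries. -/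
theorem Detectable.binary_search (g : ℕ → LowDeg p V e) (Z : Set (ZMod p)) (m : ℕ) :
    ∀ a b : ℕ, a ≤ b → b - a ≤ 2 ^ m →
      (∀ i, a ≤ i → i < b → Detectable F k fun B => P B ∧ B (g i) ∈ Z ∧ B (g (i + 1)) ∉ Z) →
      Detectable F (k + m) fun B => P B ∧ B (g a) ∈ Z ∧ B (g b) ∉ Z := by
  induction m with
  | zero =>
    intro a b hab hm h
    rcases eq_or_lt_of_le hab with rfl | hab
    · exact detectable_of_false fun B hB => hB.2.2 hB.2.1
    · obtain rfl : b = a + 1 := by rw [pow_zero] at hm; omega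
      exact h a le_rfl (by omega)
  | succ m ih =>
    intro a b hab hm h
    rw [pow_succ] at hm
    obtain ⟨c, hac, hcb, h1, h2⟩ : ∃ c, a ≤ c ∧ c ≤ b ∧ c - a ≤ 2 ^ m ∧ b - c ≤ 2 ^ m :=
      ⟨a + (b - a) / 2, by omega, by omega, by omega, by omega⟩
    rw [← add_assoc]
    refine Detectable.query (g c) fun z => ?_
    by_cases hz : z ∈ Z
    · refine (ih c b hcb h2 fun i hi hi' => h i (by omega) hi').imp ?_
      rintro B ⟨⟨h1, h3, h4⟩, rfl⟩
      exact ⟨h1, hz, h4⟩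
    · refine (ih a c hac h1 fun i hi hi' => h i hi (by omega)).imp ?_
      rintro B ⟨⟨h1, h3, h4⟩, rfl⟩
      exact ⟨h1, h3, hz⟩

end Detectable

-- Algebraic laws for the values of a map, derived from the error labels

section Values
open MvPolynomial

variable {p : ℕ} {V : Type u} {F : Finset (MvPolynomial V (ZMod p))} {e : ℕ}

theorem mono_eq_monomial (a : Finset V) :
    mono p a = monomial (∑ i ∈ a, Finsupp.single i 1) (1 : ZMod p) := by
  rw [monomial_sum_one]; rfl

theorem sum_single_one_apply_le (a : Finset V) (i : V) :
    (∑ j ∈ a, Finsupp.single j 1 : V →₀ ℕ) i ≤ 1 := by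
  classical
  rw [Finsupp.finsetSum_apply]
  simp only [Finsupp.single_apply]
  rw [Finset.sum_ite_eq']
  split <;> simp

theorem mono_mem_lowDeg {a : Finset V} (ha : a.card ≤ e) : mono p a ∈ LowDeg p V e := by
  classical
  refine Submodule.mem_inf.2 ⟨?_, ?_⟩
  · rw [mem_restrictDegree, mono_eq_monomial]
    intro s hs i
    have := support_monomial_subset hs
    rw [Finset.mem_singleton.1 this]
    exact sum_single_one_apply_le a i
  · rw [mem_restrictTotalDegree, mono]
    refine (totalDegree_finsetProd _ _).trans (le_trans (Finset.sum_le_card_nsmul _ _ 1 ?_) ?_)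
    · intro i _
      rw [X]
      exact (totalDegree_monomial_le _ _).trans (by simp)
    · simpa using ha

variable (p V) in
/-- Multilinear reduction as a linear map. -/
noncomputable def multilinMap : MvPolynomial V (ZMod p) →ₗ[ZMod p] MvPolynomial V (ZMod p) :=
  (basisMonomials V (ZMod p)).constr (ZMod p) fun m => mono p m.support

theorem multilinMap_monomial (m : V →₀ ℕ) (c : ZMod p) :
    multilinMap p V (monomial m c) = c • mono p m.support := by
  have : monomial m c = c • basisMonomials V (ZMod p) m := by
    simp [smul_monomial]
  rw [this, map_smul, multilinMap, Module.Basis.constr_basis]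

theorem multilin_eq_multilinMap (f : MvPolynomial V (ZMod p)) :
    multilin f = multilinMap p V f := by
  conv_rhs => rw [← support_sum_monomial_coeff f, map_sum]
  exact Finset.sum_congr rfl fun m _ => (multilinMap_monomial _ _).symm

theorem multilin_mem_lowDeg {f : MvPolynomial V (ZMod p)} (hf : f.totalDegree ≤ e) :
    multilin f ∈ LowDeg p V e := by
  refine Submodule.sum_mem _ fun m hm => Submodule.smul_mem _ _ (mono_mem_lowDeg ?_)
  refine le_trans ?_ ((le_totalDegree hm).trans hf)
  rw [Finset.card_eq_sum_ones]
  exact Finset.sum_le_sum fun i hi => Nat.one_le_iff_ne_zero.2 (Finsupp.mem_support_iff.1 hi)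

open scoped Classical in
/-- The multilinear representative of `f`, and `0` if the degree of `f` exceeds `e`. -/
noncomputable def toLow (e : ℕ) (f : MvPolynomial V (ZMod p)) : LowDeg p V e :=
  if h : f.totalDegree ≤ e then ⟨multilin f, multilin_mem_lowDeg h⟩ else 0

theorem coe_toLow {f : MvPolynomial V (ZMod p)} (h : f.totalDegree ≤ e) :
    (toLow e f : MvPolynomial V (ZMod p)) = multilin f := by
  simp [toLow, h]

/-- The value of `B` at the multilinear representative of `f`. -/
noncomputable def val (B : LowDeg p V e → ZMod p) (f : MvPolynomial V (ZMod p)) : ZMod p :=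
  B (toLow e f)

variable {k l : ℕ} {P P' : (LowDeg p V e → ZMod p) → Prop} {f g : MvPolynomial V (ZMod p)}

theorem detectable_add (hf : f.totalDegree ≤ e) (hg : g.totalDegree ≤ e) :
    Detectable F (e := e) k fun B => val B (f + g) ≠ val B f + val B g := by
  refine detectable_of_isError (.add (toLow e f) (toLow e g)) fun B hB h => hB ?_
  have : toLow e (f + g) = toLow e f + toLow e g := by
    apply Subtype.ext
    rw [Submodule.coe_add, coe_toLow hf, coe_toLow hg,
      coe_toLow ((totalDegree_add f g).trans (max_le hf hg))]
    simp [multilin_eq_multilinMap]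
  rw [val, this]
  exact h.symm

theorem detectable_C (c : ZMod p) : Detectable F (e := e) k fun B => val B (C c) ≠ c := by
  refine detectable_of_isError (.const c) fun B hB => ⟨toLow e (C c), ?_, hB⟩
  rw [coe_toLow (by simp), multilin_eq_multilinMap, C_apply, multilinMap_monomial]
  simp [mono, smul_eq_C_mul]

theorem detectable_zero : Detectable F (e := e) k fun B => val B 0 ≠ 0 := by
  simpa using detectable_C (F := F) (e := e) (k := k) 0

theorem detectable_one : Detectable F (e := e) k fun B => val B 1 ≠ 1 := by
  simpa using detectable_C (F := F) (e := e) (k := k) 1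

theorem detectable_X [Fact p.Prime] (he : 1 ≤ e) (x : V) :
    Detectable F (e := e) k fun B => val B (X x) ≠ 0 ∧ val B (X x) ≠ 1 := by
  refine detectable_of_isError (.var x) fun _ hB => ⟨toLow e (X x), ?_, hB⟩
  rw [coe_toLow (by simpa using he), multilin_eq_multilinMap, X, multilinMap_monomial]
  simp [mono, X]

theorem detectable_eqn (hf : f ∈ F) (he : f.totalDegree ≤ e) :
    Detectable F (e := e) k fun B => val B f ≠ 0 :=
  detectable_of_isError (.eqn f hf) fun B hB => ⟨toLow e f, coe_toLow he, hB⟩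

theorem detectable_nsmul (hf : f.totalDegree ≤ e) (n : ℕ) :
    Detectable F (e := e) (3 * n) fun B => val B (n • f) ≠ n * val B f := by
  induction n with
  | zero => simpa using detectable_zero
  | succ n ih =>
    refine (ih.cases (detectable_add (k := 0) (f := n • f) ?_ hf) fun B hB => ?_).le (by omega)
    · exact (totalDegree_smul_le _ _).trans hf
    · by_contra! h
      rw [succ_nsmul, h.2, h.1] at hB
      exact hB (by push_cast; ring)

/-- No label concerns scalar multiples. Over the prime field `c * f` is a sum of `c.val < p` copies
of `f`, so additivity suffices. -/
theorem detectable_C_mul [Fact p.Prime] (hf : f.totalDegree ≤ e) (c : ZMod p) :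
    Detectable F (e := e) (3 * p) fun B => val B (C c * f) ≠ c * val B f := by
  refine (detectable_nsmul hf c.val).mono (fun B hB => ?_) (by have := ZMod.val_lt c; omega)
  rw [nsmul_eq_mul, ← map_natCast (C (σ := V) (R := ZMod p))]
  simpa using hB

theorem detectable_neg [Fact p.Prime] (hf : f.totalDegree ≤ e) :
    Detectable F (e := e) (3 * p) fun B => val B (-f) ≠ -val B f := by
  simpa using detectable_C_mul (F := F) hf (-1)

theorem detectable_sub [Fact p.Prime] (hf : f.totalDegree ≤ e) (hg : g.totalDegree ≤ e) :
    Detectable F (e := e) (3 * p + 3) fun B => val B (f - g) ≠ val B f - val B g := by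
  refine ((detectable_neg hg).cases (detectable_add (k := 0) hf (g := -g) (by simpa using hg))
    fun B hB => ?_)
  by_contra! h
  rw [sub_eq_add_neg, h.2, h.1] at hB
  exact hB (by ring)

/-- Multilinear reduction retains only the support of an exponent vector, and the support of `a + b`
is the union of the supports, so this is an instance of the label `mul`. -/
theorem detectable_monomial_mul [Fact p.Prime] {a b : V →₀ ℕ} (h : a.degree + b.degree ≤ e) :
    Detectable F (e := e) k fun B =>
      val B (monomial (a + b) 1) ≠ val B (monomial a 1) * val B (monomial b 1) := by
  classical
  have key : ∀ m : V →₀ ℕ, m.degree ≤ e →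
      (toLow e (monomial m (1 : ZMod p)) : MvPolynomial V (ZMod p)) = mono p m.support := by
    intro m hm
    rw [coe_toLow, multilin_eq_multilinMap, multilinMap_monomial, one_smul]
    exact (totalDegree_monomial_le _ _).trans hm
  refine detectable_of_isError (.mul a.support b.support) fun B hB =>
    ⟨toLow e (monomial a 1), toLow e (monomial b 1), toLow e (monomial (a + b) 1),
      key _ (by omega), key _ (by omega), ?_, fun h => hB h.symm⟩
  rw [key _ (by simpa using h), Finsupp.support_add_eq_union]

/-- Binary search for a summand at which two sums differ. -/
theorem Detectable.sum {ι : Type*} (G H : ι → MvPolynomial V (ZMod p)) (c : ZMod p) (m : ℕ) :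
    ∀ s : List ι, s.length ≤ 2 ^ m →
      (∀ x ∈ s, (G x).totalDegree ≤ e) → (∀ x ∈ s, (H x).totalDegree ≤ e) →
      (∀ x ∈ s, Detectable F k fun B => P B ∧ val B (G x) ≠ c * val B (H x)) →
      Detectable F (k + 8 * m) fun B =>
        P B ∧ val B (s.map G).sum ≠ c * val B (s.map H).sum := by
  have hdeg : ∀ (G : ι → MvPolynomial V (ZMod p)) (s : List ι),
      (∀ x ∈ s, (G x).totalDegree ≤ e) → ((s.map G).sum).totalDegree ≤ e := by
    intro G s
    induction s with
    | nil => simp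
    | cons x s ih =>
      intro h
      rw [List.map_cons, List.sum_cons]
      exact (totalDegree_add _ _).trans
        (max_le (h x (by simp)) (ih fun y hy => h y (by simp [hy])))
  induction m with
  | zero =>
    intro s hs hG hH h
    match s, hs with
    | [], _ =>
      refine (detectable_zero (k := 0)).mono (fun B hB h0 => hB.2 ?_) (by omega)
      simp [h0]
    | [x], _ => simpa using h x (by simp)
  | succ m ih =>
    intro s hs hG hH h
    rw [pow_succ] at hs
    have hl : (s.take (2 ^ m)).length ≤ 2 ^ m := by simp
    have hr : (s.drop (2 ^ m)).length ≤ 2 ^ m := by simp; omega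
    have hml : ∀ x ∈ s.take (2 ^ m), x ∈ s := fun x => List.mem_of_mem_take
    have hmr : ∀ x ∈ s.drop (2 ^ m), x ∈ s := fun x => List.mem_of_mem_drop
    have hs' : s = s.take (2 ^ m) ++ s.drop (2 ^ m) := (List.take_append_drop _ _).symm
    generalize s.take (2 ^ m) = s₁ at *
    generalize s.drop (2 ^ m) = s₂ at *
    subst hs'
    have h1 := ih s₁ hl (fun x hx => hG x (hml x hx)) (fun x hx => hH x (hml x hx))
      fun x hx => h x (hml x hx)
    have h2 := ih s₂ hr (fun x hx => hG x (hmr x hx)) (fun x hx => hH x (hmr x hx))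
      fun x hx => h x (hmr x hx)
    have dG1 := hdeg G s₁ fun x hx => hG x (hml x hx)
    have dG2 := hdeg G s₂ fun x hx => hG x (hmr x hx)
    have dH1 := hdeg H s₁ fun x hx => hH x (hml x hx)
    have dH2 := hdeg H s₂ fun x hx => hH x (hmr x hx)
    -- The values of both sums on the left half are asked for. If they disagree, the search goes
    -- left; if they agree, the difference lies on the right unless additivity fails at one of the
    -- two splittings.
    refine (Detectable.query_list (k := k + 8 * m + 3 + 3)
      [toLow e (s₁.map G).sum, toLow e (s₁.map H).sum] _ fun B₀ => ?_).le (by simp; omega)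
    simp only [List.mem_cons, List.not_mem_nil, or_false, forall_eq_or_imp, forall_eq,
      List.map_append, List.sum_append]
    by_cases hc : val B₀ (s₁.map G).sum = c * val B₀ (s₁.map H).sum
    · refine ((h2.or (detectable_add (k := 0) dG1 dG2)).cases (detectable_add (k := 0) dH1 dH2)
        fun B hB => ?_)
      obtain ⟨⟨hP, hne⟩, e1, e2⟩ := hB
      by_contra! hcon
      rw [hcon.2, hcon.1.2, hcon.1.1 hP] at hne
      simp only [val, ← e1, ← e2] at hc hne
      rw [hc] at hne
      exact hne (by ring)
    · refine h1.mono (fun B hB => ⟨hB.1.1, ?_⟩) (by omega)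
      obtain ⟨-, e1, e2⟩ := hB
      simpa only [val, e1, e2] using hc

/-- Two nested binary searches: a failure for `f * g` is traced to one monomial of `f` times `g`,
and then to a pair of monomials. There the product rule for monomials and three scalar rules decide.
Only the logarithm `m` of the number of monomials enters the cost. -/
theorem detectable_mul [Fact p.Prime] {m : ℕ} (hf : f.support.card ≤ 2 ^ m)
    (hg : g.support.card ≤ 2 ^ m) (hd : f.totalDegree + g.totalDegree ≤ e) :
    Detectable F (e := e) (16 * m + 9 * p + 20) fun B => val B (f * g) ≠ val B f * val B g := by
  have sum_eq : ∀ f : MvPolynomial V (ZMod p),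
      (f.support.toList.map fun m => monomial m (f.coeff m)).sum = f := fun f => by
    rw [Finset.sum_map_toList, support_sum_monomial_coeff]
  have degle : ∀ (f : MvPolynomial V (ZMod p)) (m : V →₀ ℕ) (c : ZMod p),
      m ∈ f.support.toList → (monomial m c).totalDegree ≤ f.totalDegree := fun f m c hm =>
    (totalDegree_monomial_le _ _).trans (le_totalDegree (Finset.mem_toList.1 hm))
  have leaf : ∀ a ∈ f.support.toList, ∀ b ∈ g.support.toList,
      Detectable F (e := e) (9 * p + 9) fun B =>
        val B (monomial b (g.coeff b) * monomial a (f.coeff a)) ≠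
          val B (monomial a (f.coeff a)) * val B (monomial b (g.coeff b)) := by
    intro a ha b hb
    have ea : ∀ (m : V →₀ ℕ) (c : ZMod p), monomial m c = C c * monomial m 1 := fun m c => by
      rw [C_mul_monomial, mul_one]
    have da : a.degree ≤ f.totalDegree := le_totalDegree (Finset.mem_toList.1 ha)
    have db : b.degree ≤ g.totalDegree := le_totalDegree (Finset.mem_toList.1 hb)
    have d1 : ∀ m : V →₀ ℕ, (monomial m (1 : ZMod p)).totalDegree ≤ m.degree :=
      fun m => totalDegree_monomial_le _ _
    refine ((((detectable_C_mul (f := monomial a 1) ((d1 a).trans (by omega)) (f.coeff a)).or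
      (detectable_C_mul (f := monomial b 1) ((d1 b).trans (by omega)) (g.coeff b))).or
      (detectable_C_mul (f := monomial (a + b) 1) ((d1 _).trans (by simp; omega))
        (f.coeff a * g.coeff b))).cases
      (detectable_monomial_mul (k := 0) (a := a) (b := b) (by omega)) fun B hB => ?_).le (by omega)
    by_contra! h
    have : monomial b (g.coeff b) * monomial a (f.coeff a) =
        C (f.coeff a * g.coeff b) * monomial (a + b) 1 := by
      rw [monomial_mul, C_mul_monomial, mul_one, add_comm, mul_comm]
    rw [this, ea a, ea b, h.1.2, h.2, h.1.1.1, h.1.1.2] at hB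
    exact hB (by ring)
  -- `Detectable.sum` compares with a constant multiple, so the value of the factor that stays fixed
  -- is asked for first; the inner search does the same with the roles exchanged.
  refine (Detectable.query (k := 16 * m + 9 * p + 19) (toLow e g) fun c => ?_).le (by omega)
  have main := Detectable.sum (F := F) (e := e) (k := 9 * p + 9 + 8 * m + 1)
    (P := fun B => val B g = c)
    (fun a => monomial a (f.coeff a) * g) (fun a => monomial a (f.coeff a)) c m f.support.toList
    (by simpa using hf)
    (fun a ha => (totalDegree_mul _ _).trans (by have := degle f a (f.coeff a) ha; omega))
    (fun a ha => (degle f a (f.coeff a) ha).trans (by omega)) fun a ha => ?_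
  · refine main.mono (fun B hB => ⟨hB.2, ?_⟩) (by omega)
    rw [List.sum_map_mul_right, sum_eq f]
    obtain ⟨h1, rfl⟩ := hB
    rw [mul_comm (B _)]
    exact h1
  · refine Detectable.query (toLow e (monomial a (f.coeff a))) fun c' => ?_
    have inner := Detectable.sum (F := F) (e := e) (k := 9 * p + 9)
      (P := fun B => val B (monomial a (f.coeff a)) = c')
      (fun b => monomial b (g.coeff b) * monomial a (f.coeff a))
      (fun b => monomial b (g.coeff b)) c' m g.support.toList (by simpa using hg)
      (fun b hb => (totalDegree_mul _ _).trans (by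
        have := degle f a (f.coeff a) ha; have := degle g b (g.coeff b) hb; omega))
      (fun b hb => (degle g b (g.coeff b) hb).trans (by omega)) fun b hb => ?_
    · refine inner.imp fun B hB => ⟨hB.2, ?_⟩
      rw [List.sum_map_mul_right, sum_eq g, mul_comm g]
      obtain ⟨⟨rfl, h1⟩, rfl⟩ := hB
      rw [mul_comm (B _)]
      exact h1
    · refine (leaf a ha b hb).imp fun B hB => ?_
      obtain ⟨rfl, h⟩ := hB
      exact h

end Values

-- Counting monomials; products and powers

section Products
open MvPolynomial

variable {p : ℕ} {V : Type u} {F : Finset (MvPolynomial V (ZMod p))} {e : ℕ}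

/-- A monomial of degree at most `M` is spelled by a word of `M` letters, each a variable or a blank
(`none`), which explains the base `Fintype.card V + 1`. -/
theorem exists_finset_degree_le (V : Type u) [Fintype V] (M : ℕ) :
    ∃ S : Finset (V →₀ ℕ), S.card ≤ (Fintype.card V + 1) ^ M ∧ ∀ m, m.degree ≤ M → m ∈ S := by
  classical
  induction M with
  | zero => exact ⟨{0}, by simp, fun m hm => by
      simpa using (Finsupp.degree_eq_zero_iff m).1 (Nat.le_zero.1 hm)⟩
  | succ M ih =>
    obtain ⟨S, hS, h⟩ := ih
    refine ⟨Finset.image (fun t : Option V × (V →₀ ℕ) =>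
      t.2 + t.1.elim 0 fun x => Finsupp.single x 1) (Finset.univ ×ˢ S), ?_, fun m hm => ?_⟩
    · refine Finset.card_image_le.trans ?_
      rw [Finset.card_product, Finset.card_univ, Fintype.card_option, pow_succ, mul_comm]
      exact Nat.mul_le_mul_right _ hS
    · rw [Finset.mem_image]
      rcases eq_or_ne m 0 with rfl | hm0
      · exact ⟨(none, 0), by simpa using h 0 (by simp), by simp⟩
      · obtain ⟨x, hx⟩ := Finsupp.ne_iff.1 hm0
        have hle : Finsupp.single x 1 ≤ m := by
          rw [Finsupp.single_le_iff]
          exact Nat.one_le_iff_ne_zero.2 hx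
        have hsub := tsub_add_cancel_of_le hle
        refine ⟨(some x, m - Finsupp.single x 1), ?_, by simpa using hsub⟩
        simp only [Finset.mem_product, Finset.mem_univ, true_and]
        apply h
        have := congrArg Finsupp.degree hsub
        rw [map_add, Finsupp.degree_single] at this
        omega

theorem card_support_le [Fintype V] {H M : ℕ} (hV : Fintype.card V + 1 ≤ 2 ^ H)
    {f : MvPolynomial V (ZMod p)} (hf : f.totalDegree ≤ M) : f.support.card ≤ 2 ^ (H * M) := by
  obtain ⟨S, hS, h⟩ := exists_finset_degree_le V M
  calc f.support.card ≤ S.card :=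
        Finset.card_le_card fun m hm => h m ((le_totalDegree hm).trans hf)
    _ ≤ (2 ^ H) ^ M := hS.trans (Nat.pow_le_pow_left hV M)
    _ = 2 ^ (H * M) := (pow_mul _ _ _).symm

/-- Number of queries that detect a failure of multiplicativity for polynomials of degree at
most `M` in fewer than `2 ^ H` variables. -/
def mulCost (p H M : ℕ) : ℕ := 16 * (H * M) + 9 * p + 20

variable [Fact p.Prime] [Fintype V] {H M : ℕ} {f g : MvPolynomial V (ZMod p)}

theorem detectable_mul_of_le (hV : Fintype.card V + 1 ≤ 2 ^ H) (hM : 2 * M ≤ e)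
    (hf : f.totalDegree ≤ M) (hg : g.totalDegree ≤ M) :
    Detectable F (e := e) (mulCost p H M) fun B => val B (f * g) ≠ val B f * val B g :=
  detectable_mul (card_support_le hV hf) (card_support_le hV hg) (by omega)

omit [Fintype V] in
theorem totalDegree_list_prod_le {ι : Type*} {G : ι → MvPolynomial V (ZMod p)} {M₀ : ℕ}
    (s : List ι) (h : ∀ x ∈ s, (G x).totalDegree ≤ M₀) :
    ((s.map G).prod).totalDegree ≤ s.length * M₀ := by
  refine (totalDegree_list_prod _).trans ?_
  have := List.sum_le_card_nsmul ((s.map G).map totalDegree) M₀ (by simpa using h)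
  simpa using this

omit [Fintype V] in
theorem totalDegree_list_sum_le {ι : Type*} {G : ι → MvPolynomial V (ZMod p)} {M₀ : ℕ}
    (s : List ι) (h : ∀ x ∈ s, (G x).totalDegree ≤ M₀) :
    ((s.map G).sum).totalDegree ≤ M₀ := by
  induction s with
  | nil => simp
  | cons x s ih =>
    rw [List.map_cons, List.sum_cons]
    exact (totalDegree_add _ _).trans
      (max_le (h x (by simp)) (ih fun y hy => h y (by simp [hy])))

theorem detectable_prod (hV : Fintype.card V + 1 ≤ 2 ^ H) (hM : 2 * M ≤ e) {M₀ : ℕ}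
    {ι : Type*} {G : ι → MvPolynomial V (ZMod p)} (s : List ι)
    (h : ∀ x ∈ s, (G x).totalDegree ≤ M₀) (hs : s.length * M₀ ≤ M) :
    Detectable F (e := e) (s.length * (mulCost p H M + 3)) fun B =>
      val B (s.map G).prod ≠ (s.map fun x => val B (G x)).prod := by
  induction s with
  | nil => simpa using detectable_one
  | cons x s ih =>
    simp only [List.length_cons, add_mul, one_mul, List.map_cons, List.prod_cons] at hs ⊢
    have h' : ∀ y ∈ s, (G y).totalDegree ≤ M₀ := fun y hy => h y (by simp [hy])
    refine ((ih h' (by omega)).cases (detectable_mul_of_le (f := G x) (g := (s.map G).prod) hV hM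
      ((h x (by simp)).trans (by omega)) ((totalDegree_list_prod_le s h').trans (by omega)))
      fun B hB => ?_).le (by omega)
    by_contra! hc
    exact hB (by rw [hc.2, hc.1])

theorem detectable_pow (hV : Fintype.card V + 1 ≤ 2 ^ H) (hM : 2 * M ≤ e) {M₀ : ℕ}
    (hf : f.totalDegree ≤ M₀) (n : ℕ) (hs : n * M₀ ≤ M) :
    Detectable F (e := e) (n * (mulCost p H M + 3)) fun B => val B (f ^ n) ≠ val B f ^ n := by
  have := detectable_prod (F := F) (e := e) hV hM (G := id) (List.replicate n f)
    (M₀ := M₀) (by simp +contextual [List.mem_replicate, hf]) (by simpa using hs)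
  simpa using this

end Products

-- Blocks of disjunctions, subformulas, size and depth

namespace Formula

variable {p : ℕ} {V : Type u}

mutual
/-- The disjuncts of the outermost block of disjunctions. -/
def flat : Formula p V → List (Formula p V)
  | var x => [var x]
  | neg φ => [neg φ]
  | or φs => flatAll φs
  | mod i φs => [mod i φs]
/-- The concatenation of the lists of disjuncts. -/
def flatAll : List (Formula p V) → List (Formula p V)
  | [] => []
  | φ :: φs => flat φ ++ flatAll φs
end

mutual
/-- All subformulas, with the formula itself. -/
def subs : Formula p V → List (Formula p V)
  | var x => [var x]
  | neg φ => neg φ :: subs φ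
  | or φs => or φs :: subsAll φs
  | mod i φs => mod i φs :: subsAll φs
/-- All subformulas of the members of the list. -/
def subsAll : List (Formula p V) → List (Formula p V)
  | [] => []
  | φ :: φs => subs φ ++ subsAll φs
end

theorem mem_flatAll {a : Formula p V} {φs : List (Formula p V)} :
    a ∈ flatAll φs ↔ ∃ φ ∈ φs, a ∈ flat φ := by
  induction φs with
  | nil => simp [flatAll]
  | cons φ φs ih => simp [flatAll, ih]

theorem mem_subsAll {a : Formula p V} {φs : List (Formula p V)} :
    a ∈ subsAll φs ↔ ∃ φ ∈ φs, a ∈ subs φ := by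
  induction φs with
  | nil => simp [subsAll]
  | cons φ φs ih => simp [subsAll, ih]

theorem size_le_sizeSum {φ : Formula p V} {φs : List (Formula p V)} (h : φ ∈ φs) :
    φ.size ≤ sizeSum φs := by
  induction φs with
  | nil => simp at h
  | cons ψ φs ih =>
    rw [sizeSum]
    rcases List.mem_cons.1 h with rfl | h
    · omega
    · have := ih h; omega

theorem depth_le_depthMax {φ : Formula p V} {φs : List (Formula p V)} (h : φ ∈ φs) :
    φ.depth ≤ depthMax φs := by
  induction φs with
  | nil => simp at h
  | cons ψ φs ih =>
    rw [depthMax]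
    rcases List.mem_cons.1 h with rfl | h
    · omega
    · have := ih h; omega

theorem le_depthUnderOr {φ : Formula p V} {φs : List (Formula p V)} (h : φ ∈ φs) :
    (if φ.IsOr then φ.depth else φ.depth + 1) ≤ depthUnderOr φs := by
  induction φs with
  | nil => simp at h
  | cons ψ φs ih =>
    rw [depthUnderOr]
    rcases List.mem_cons.1 h with rfl | h
    · exact le_max_left _ _
    · exact (ih h).trans (le_max_right _ _)

theorem depth_le_neg (φ : Formula p V) : φ.depth ≤ (neg φ).depth := by
  simp only [depth]; split <;> omega

theorem size_pos (φ : Formula p V) : 1 ≤ φ.size := by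
  cases φ <;> simp [size]

@[elab_as_elim]
-- Members of `flatAll` may be nested several disjunctions down, where an induction over immediate
-- subformulas does not reach them; they are still smaller.
theorem size_induction {C : Formula p V → Prop}
    (h : ∀ φ : Formula p V, (∀ ψ : Formula p V, ψ.size < φ.size → C ψ) → C φ)
    (φ : Formula p V) : C φ := by
  suffices ∀ n, ∀ φ : Formula p V, φ.size < n → C φ from this _ φ (Nat.lt_succ_self _)
  intro n
  induction n with
  | zero => intro φ hφ; omega
  | succ n ih => exact fun φ hφ => h φ fun ψ hψ => ih ψ (by omega)

theorem size_lt_or {φ : Formula p V} {φs : List (Formula p V)} (h : φ ∈ φs) :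
    φ.size < (or φs).size := by
  have := size_le_sizeSum h
  rw [size]; omega

theorem size_lt_mod {φ : Formula p V} {φs : List (Formula p V)} (i : ZMod p) (h : φ ∈ φs) :
    φ.size < (mod i φs).size := by
  have := size_le_sizeSum h
  rw [size]; omega

theorem flat_of_not_isOr {φ : Formula p V} (h : φ.IsOr = false) : flat φ = [φ] := by
  cases φ <;> simp_all [flat, IsOr]

theorem size_le_of_mem_flat (φ : Formula p V) : ∀ a ∈ flat φ, a.size ≤ φ.size := by
  induction φ using size_induction
  rename_i φ ih
  intro a ha
  cases φ with
  | or φs =>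
    rw [flat, mem_flatAll] at ha
    obtain ⟨φ, hφ, ha⟩ := ha
    exact (ih φ (size_lt_or hφ) a ha).trans (size_lt_or hφ).le
  | _ => simp only [flat, List.mem_singleton] at ha; subst ha; exact le_rfl

theorem size_lt_of_mem_flatAll {a : Formula p V} {φs : List (Formula p V)} (h : a ∈ flatAll φs) :
    a.size < (or φs).size := by
  obtain ⟨φ, hφ, ha⟩ := mem_flatAll.1 h
  exact (size_le_of_mem_flat φ a ha).trans_lt (size_lt_or hφ)

/-- Members of a block are not disjunctions, so passing from the block to a member lowers the depth
by at least one. This is why approximating whole blocks costs one factor in the degree per unit of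
depth. -/
theorem depth_lt_of_mem_flat (φ : Formula p V) :
    ∀ a ∈ flat φ, (if φ.IsOr then a.depth + 1 else a.depth) ≤ φ.depth := by
  induction φ using size_induction
  rename_i φ ih
  intro a ha
  cases φ with
  | or φs =>
    rw [flat, mem_flatAll] at ha
    obtain ⟨φ, hφ, ha⟩ := ha
    have h1 := ih φ (size_lt_or hφ) a ha
    have h2 := le_depthUnderOr hφ
    rw [if_pos (show (or φs).IsOr = true from rfl), depth]
    refine le_trans ?_ (le_max_right _ _)
    split_ifs at h1 h2 <;> omega
  | _ => simp only [flat, List.mem_singleton] at ha; subst ha; simp [IsOr]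

theorem depth_lt_of_mem_flatAll {a : Formula p V} {φs : List (Formula p V)}
    (h : a ∈ flatAll φs) : a.depth + 1 ≤ (or φs).depth := by
  simpa [IsOr] using depth_lt_of_mem_flat (or φs) a (by rwa [flat])

theorem length_flatAll_le (φs : List (Formula p V)) : (flatAll φs).length ≤ sizeSum φs := by
  suffices h : ∀ φ : Formula p V, (flat φ).length ≤ φ.size by
    induction φs with
    | nil => simp [flatAll, sizeSum]
    | cons φ φs ih => have := h φ; simp only [flatAll, sizeSum, List.length_append]; omega
  intro φ
  induction φ using size_induction
  rename_i φ ih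
  cases φ with
  | or φs =>
    rw [flat, size]
    refine le_trans ?_ (Nat.le_succ _)
    have h : ∀ φ ∈ φs, (flat φ).length ≤ φ.size := fun φ hφ => ih φ (size_lt_or hφ)
    clear ih
    induction φs with
    | nil => simp [flatAll]
    | cons φ φs ih =>
      have h1 := h φ (by simp)
      have h2 := ih fun ψ hψ => h ψ (by simp [hψ])
      simp only [flatAll, sizeSum, List.length_append]; omega
  | _ => simp [flat, size]

theorem mem_subs_self (φ : Formula p V) : φ ∈ subs φ := by
  cases φ <;> simp [subs]

theorem length_subs (φ : Formula p V) : (subs φ).length = φ.size := by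
  have aux : ∀ φs : List (Formula p V), (∀ φ ∈ φs, (subs φ).length = φ.size) →
      (subsAll φs).length = sizeSum φs := by
    intro φs
    induction φs with
    | nil => simp [subsAll, sizeSum]
    | cons φ φs ih =>
      intro h
      simp [subsAll, sizeSum, ih fun ψ hψ => h ψ (by simp [hψ]), h φ (by simp)]
  induction φ using size_induction
  rename_i φ ih
  cases φ with
  | var x => simp [subs, size]
  | neg φ => simp [subs, size, ih φ (by simp [size])]
  | or φs => simp [subs, size, aux φs fun φ hφ => ih φ (size_lt_or hφ)]
  | mod i φs => simp [subs, size, aux φs fun φ hφ => ih φ (size_lt_mod i hφ)]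

/-- A set of formulas that contains the immediate subformulas of its members. -/
structure SubClosed (R : Set (Formula p V)) : Prop where
  neg : ∀ {φ}, neg φ ∈ R → φ ∈ R
  or : ∀ {φs}, or φs ∈ R → ∀ φ ∈ φs, φ ∈ R
  mod : ∀ {i φs}, mod i φs ∈ R → ∀ φ ∈ φs, φ ∈ R

theorem subClosed_subs (φ : Formula p V) : SubClosed {ψ | ψ ∈ subs φ} := by
  induction φ using size_induction
  rename_i φ ih
  cases φ with
  | var x => constructor <;> simp [subs]
  | neg φ =>
    have ih := ih φ (by simp [size])
    constructor
    · intro ψ hψ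
      rcases List.mem_cons.1 hψ with h | h
      · injection h with h; subst h; exact List.mem_cons_of_mem _ (mem_subs_self _)
      · exact List.mem_cons_of_mem _ (ih.neg h)
    · intro φs h φ hφ
      rcases List.mem_cons.1 h with h | h
      · cases h
      · exact List.mem_cons_of_mem _ (ih.or h φ hφ)
    · intro i φs h φ hφ
      rcases List.mem_cons.1 h with h | h
      · cases h
      · exact List.mem_cons_of_mem _ (ih.mod h φ hφ)
  | or χs =>
    constructor
    · intro ψ hψ
      rcases List.mem_cons.1 hψ with h | h
      · cases h
      · obtain ⟨χ, hχ, h⟩ := mem_subsAll.1 h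
        exact List.mem_cons_of_mem _ (mem_subsAll.2 ⟨χ, hχ, (ih χ (size_lt_or hχ)).neg h⟩)
    · intro φs h φ hφ
      rcases List.mem_cons.1 h with h | h
      · injection h with h; subst h
        exact List.mem_cons_of_mem _ (mem_subsAll.2 ⟨φ, hφ, mem_subs_self _⟩)
      · obtain ⟨χ, hχ, h⟩ := mem_subsAll.1 h
        exact List.mem_cons_of_mem _ (mem_subsAll.2 ⟨χ, hχ, (ih χ (size_lt_or hχ)).or h φ hφ⟩)
    · intro i φs h φ hφ
      rcases List.mem_cons.1 h with h | h
      · cases h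
      · obtain ⟨χ, hχ, h⟩ := mem_subsAll.1 h
        exact List.mem_cons_of_mem _ (mem_subsAll.2 ⟨χ, hχ, (ih χ (size_lt_or hχ)).mod h φ hφ⟩)
  | mod c χs =>
    constructor
    · intro ψ hψ
      rcases List.mem_cons.1 hψ with h | h
      · cases h
      · obtain ⟨χ, hχ, h⟩ := mem_subsAll.1 h
        exact List.mem_cons_of_mem _ (mem_subsAll.2 ⟨χ, hχ, (ih χ (size_lt_mod c hχ)).neg h⟩)
    · intro φs h φ hφ
      rcases List.mem_cons.1 h with h | h
      · cases h
      · obtain ⟨χ, hχ, h⟩ := mem_subsAll.1 h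
        exact List.mem_cons_of_mem _ (mem_subsAll.2 ⟨χ, hχ, (ih χ (size_lt_mod c hχ)).or h φ hφ⟩)
    · intro i φs h φ hφ
      rcases List.mem_cons.1 h with h | h
      · injection h with _ h; subst h
        exact List.mem_cons_of_mem _ (mem_subsAll.2 ⟨φ, hφ, mem_subs_self _⟩)
      · obtain ⟨χ, hχ, h⟩ := mem_subsAll.1 h
        exact List.mem_cons_of_mem _ (mem_subsAll.2 ⟨χ, hχ, (ih χ (size_lt_mod c hχ)).mod h φ hφ⟩)

end Formula

/-! ### Random polynomial approximations of formulas -/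

section Approximation
open MvPolynomial Formula

variable {p : ℕ} {V : Type u}

/-- A linear combination of the polynomials in a list. -/
noncomputable def linComb (c : ℕ → ZMod p) (l : List (MvPolynomial V (ZMod p))) :
    MvPolynomial V (ZMod p) :=
  ∑ j ∈ Finset.range l.length, C (c j) * l.getD j 0

/-- The approximation of a disjunction by means of `h` linear combinations of the disjuncts. -/
noncomputable def orApprox (h : ℕ) (c : ℕ → ℕ → ZMod p) (l : List (MvPolynomial V (ZMod p))) :
    MvPolynomial V (ZMod p) :=
  1 - ∏ i ∈ Finset.range h, (1 - linComb (c i) l ^ (p - 1))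

/-- The polynomial approximating a formula, for a choice `ρ` of coefficients. -/
noncomputable def hat (h : ℕ) (ρ : Formula p V → ℕ → ℕ → ZMod p) :
    Formula p V → MvPolynomial V (ZMod p)
  | .var x => X x
  | .neg φ => 1 - hat h ρ φ
  | .mod i φs => 1 - ((φs.attach.map fun φ => hat h ρ φ.1).sum - C i) ^ (p - 1)
  | .or φs => orApprox h (ρ (.or φs)) ((flatAll φs).attach.map fun φ => hat h ρ φ.1)
termination_by φ => φ.size
decreasing_by
  · simp [Formula.size]
  · exact size_lt_mod i φ.2
  · exact size_lt_of_mem_flatAll φ.2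

variable {h : ℕ} {ρ ρ' : Formula p V → ℕ → ℕ → ZMod p}

theorem hat_var (x : V) : hat h ρ (.var x) = X x := by rw [hat]

theorem hat_neg (φ : Formula p V) : hat h ρ (.neg φ) = 1 - hat h ρ φ := by rw [hat]

theorem hat_mod (i : ZMod p) (φs : List (Formula p V)) :
    hat h ρ (.mod i φs) = 1 - ((φs.map (hat h ρ)).sum - C i) ^ (p - 1) := by
  rw [hat, List.attach_map_val (f := hat h ρ)]

theorem hat_or (φs : List (Formula p V)) :
    hat h ρ (.or φs) = orApprox h (ρ (.or φs)) ((flatAll φs).map (hat h ρ)) := by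
  rw [hat, List.attach_map_val (f := hat h ρ)]

/-- An approximation involves no coefficients of larger formulas. Hence changing the coefficients at
a disjunction leaves the polynomials of its disjuncts alone, which the counting in `hides_injective`
relies on. -/
theorem hat_congr (φ : Formula p V) :
    (∀ ψ : Formula p V, ψ.size ≤ φ.size → ρ ψ = ρ' ψ) → hat h ρ φ = hat h ρ' φ := by
  induction φ using size_induction
  rename_i φ ih
  intro hφ
  cases φ with
  | var x => rw [hat_var, hat_var]
  | neg φ =>
    have : φ.size < (neg φ).size := by simp [Formula.size]
    rw [hat_neg, hat_neg, ih φ this fun ψ hψ => hφ ψ (hψ.trans this.le)]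
  | mod i φs =>
    rw [hat_mod, hat_mod, List.map_congr_left fun φ hm => ih φ (size_lt_mod i hm)
      fun ψ hψ => hφ ψ (hψ.trans (size_lt_mod i hm).le)]
  | or φs =>
    rw [hat_or, hat_or, hφ _ le_rfl, List.map_congr_left fun φ hm =>
      ih φ (size_lt_of_mem_flatAll hm)
      fun ψ hψ => hφ ψ (hψ.trans (size_lt_of_mem_flatAll hm).le)]

theorem linComb_add (c c' : ℕ → ZMod p) (l : List (MvPolynomial V (ZMod p))) :
    linComb (c + c') l = linComb c l + linComb c' l := by
  simp [linComb, ← Finset.sum_add_distrib, add_mul]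

theorem linComb_single {j : ℕ} (a : ZMod p) {l : List (MvPolynomial V (ZMod p))}
    (hj : j < l.length) : linComb (Pi.single j a) l = C a * l.getD j 0 := by
  rw [linComb, Finset.sum_eq_single j]
  · simp
  · intro i _ hi; simp [hi]
  · simp [hj]

theorem totalDegree_linComb_le {M : ℕ} (c : ℕ → ZMod p) {l : List (MvPolynomial V (ZMod p))}
    (hl : ∀ f ∈ l, f.totalDegree ≤ M) : (linComb c l).totalDegree ≤ M := by
  refine totalDegree_finsetSum_le fun j hj => (totalDegree_mul _ _).trans ?_
  rw [totalDegree_C, zero_add]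
  rw [Finset.mem_range] at hj
  rw [List.getD_eq_getElem _ _ hj]
  exact hl _ (List.getElem_mem hj)

theorem totalDegree_one_sub_le {M : ℕ} {f : MvPolynomial V (ZMod p)} (hf : f.totalDegree ≤ M) :
    (1 - f).totalDegree ≤ M :=
  (totalDegree_sub _ _).trans (max_le (by simp) hf)

theorem totalDegree_pow_le {M : ℕ} {f : MvPolynomial V (ZMod p)} (hf : f.totalDegree ≤ M)
    (n : ℕ) : (f ^ n).totalDegree ≤ n * M :=
  (totalDegree_pow _ _).trans (Nat.mul_le_mul_left _ hf)

theorem totalDegree_orApprox_le {M : ℕ} (c : ℕ → ℕ → ZMod p)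
    {l : List (MvPolynomial V (ZMod p))} (hl : ∀ f ∈ l, f.totalDegree ≤ M) :
    (orApprox h c l).totalDegree ≤ h * ((p - 1) * M) := by
  refine totalDegree_one_sub_le ((totalDegree_finsetProd _ _).trans
    ((Finset.sum_le_card_nsmul _ _ ((p - 1) * M) fun i _ => ?_).trans (by simp)))
  exact totalDegree_one_sub_le (totalDegree_pow_le (totalDegree_linComb_le _ hl) _)

/-- A block of disjunctions multiplies the degree by at most `h * (p - 1)`, a `MOD` connective by at
most `p - 1`, and a negation does not raise it. -/
theorem totalDegree_hat_le [Fact p.Prime] (hh : 1 ≤ h) (φ : Formula p V) :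
    (hat h ρ φ).totalDegree ≤ (h * p) ^ φ.depth := by
  have hp : 1 ≤ p := (Fact.out : p.Prime).one_le
  have hM : 1 ≤ h * p := Nat.mul_pos hh hp
  induction φ using size_induction
  rename_i φ ih
  cases φ with
  | var x => rw [hat_var, totalDegree_X]; exact Nat.one_le_pow _ _ hM
  | neg φ =>
    rw [hat_neg]
    refine totalDegree_one_sub_le ((ih φ (by simp [Formula.size])).trans ?_)
    exact Nat.pow_le_pow_right hM (depth_le_neg φ)
  | mod i φs =>
    rw [hat_mod, depth, pow_succ]
    refine totalDegree_one_sub_le ((totalDegree_pow_le (M := (h * p) ^ depthMax φs) ?_ _).trans ?_)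
    · refine (totalDegree_sub _ _).trans (max_le (totalDegree_list_sum_le _ fun φ hφ => ?_)
        (by simp))
      exact (ih φ (size_lt_mod i hφ)).trans (Nat.pow_le_pow_right hM (depth_le_depthMax hφ))
    · rw [mul_comm]
      exact Nat.mul_le_mul_left _ ((Nat.sub_le p 1).trans (Nat.le_mul_of_pos_left _ hh))
  | or φs =>
    have hd : 1 ≤ (or φs).depth := by rw [depth]; exact le_max_left _ _
    obtain ⟨k, hk⟩ : ∃ k, (or φs).depth = k + 1 := ⟨(or φs).depth - 1, by omega⟩
    rw [hat_or, hk, pow_succ]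
    refine (totalDegree_orApprox_le (M := (h * p) ^ k) _ ?_).trans ?_
    · intro f hf
      obtain ⟨a, ha, rfl⟩ := List.mem_map.1 hf
      have := depth_lt_of_mem_flatAll ha
      exact (ih a (size_lt_of_mem_flatAll ha)).trans (Nat.pow_le_pow_right hM (by omega))
    · rw [← mul_assoc, mul_comm]
      exact Nat.mul_le_mul_left _ (Nat.mul_le_mul_left _ (Nat.sub_le p 1))

/-- Up to negations in front, every formula has the same approximation as one that is not a
negation. -/
theorem exists_hat_eq (φ : Formula p V) : ∃ ψ : Formula p V, ψ.IsNeg = false ∧ ψ.depth ≤ φ.depth ∧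
    (hat h ρ φ = hat h ρ ψ ∨ hat h ρ φ = 1 - hat h ρ ψ) := by
  induction φ using size_induction
  rename_i φ ih
  cases φ with
  | neg φ =>
    obtain ⟨ψ, h1, h2, h3⟩ := ih φ (by simp [Formula.size])
    refine ⟨ψ, h1, h2.trans (depth_le_neg φ), ?_⟩
    rw [hat_neg]
    rcases h3 with h3 | h3
    · exact .inr (by rw [h3])
    · exact .inl (by rw [h3]; ring)
  | _ => exact ⟨_, rfl, le_rfl, .inl rfl⟩

end Approximation

-- Truth values under a map, and the laws for single connectives

section Consistency
open MvPolynomial Formula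

variable {p : ℕ} {V : Type u}

/-- The formula is considered true if the value of its approximation is not zero. -/
def Holds {e : ℕ} (h : ℕ) (ρ : Formula p V → ℕ → ℕ → ZMod p) (B : LowDeg p V e → ZMod p)
    (φ : Formula p V) : Prop := val B (hat h ρ φ) ≠ 0

/-- The coefficients `ρ` do not hide a true disjunct of a disjunction in `R`: either one of the
linear combinations has a nonzero value, or adding multiples of the true disjunct to one of them
violates linearity. -/
def Good {e : ℕ} (h : ℕ) (ρ : Formula p V → ℕ → ℕ → ZMod p) (R : Set (Formula p V))
    (B : LowDeg p V e → ZMod p) : Prop :=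
  ∀ φs, Formula.or φs ∈ R → ∀ a ∈ flatAll φs, Holds h ρ B a →
    (∃ i < h, val B (linComb (ρ (.or φs) i) ((flatAll φs).map (hat h ρ))) ≠ 0) ∨
    ∃ i < h, ∃ c : ZMod p,
      val B (linComb (ρ (.or φs) i) ((flatAll φs).map (hat h ρ)) + C c * hat h ρ a) ≠
        val B (linComb (ρ (.or φs) i) ((flatAll φs).map (hat h ρ))) + c * val B (hat h ρ a)

/-- Numerical side conditions: formulas of depth at most `d` have approximations of degree at
most `M`, lists have length at most `2 ^ L`, and the basic violations are detected with `U`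
queries. -/
structure Budget (p : ℕ) (V : Type u) [Fintype V] (h H M L d e U : ℕ) : Prop where
  card_le : Fintype.card V + 1 ≤ 2 ^ H
  one_le : 1 ≤ h
  le_M : (h * p) ^ (d + 1) ≤ M
  le_e : 2 * M ≤ e
  cost_or : h * (mulCost p H M + 3) + h * (p * (mulCost p H M + 3) + 3 * p + 15) + 3 * p + 12 ≤ U
  cost_mod : p * (mulCost p H M + 3) + 9 * p + 30 ≤ U
  cost_search : 3 * p + 8 * L + h + 6 ≤ U
  cost_good : h * (p * (3 * p + 6) + 3) ≤ U

variable [Fact p.Prime] [Fintype V] {F : Finset (MvPolynomial V (ZMod p))}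
  {h H M L d e U : ℕ} {ρ : Formula p V → ℕ → ℕ → ZMod p} {R : Set (Formula p V)} {k : ℕ}
  {P : (LowDeg p V e → ZMod p) → Prop}

omit [Fintype V] in
theorem detectable_one_sub {f : MvPolynomial V (ZMod p)} (hf : f.totalDegree ≤ e) :
    Detectable F (e := e) (3 * p + 6) fun B => val B (1 - f) ≠ 1 - val B f := by
  refine ((detectable_one (k := 0)).cases (detectable_sub (f := 1) (by simp) hf)
    fun B hB => ?_).le (by omega)
  by_contra! hc
  exact hB (by rw [hc.2, hc.1])

section Degrees

variable (hb : Budget p V h H M L d e U)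
include hb

omit [Fact p.Prime] in
-- The exponent `d + 1` in the budget leaves a spare factor `h * p` above the degree bound for
-- approximations; it pays for the powers and the product of `h` factors formed while evaluating one
-- connective.
theorem Budget.hp_pow_mul_le : h * (p * (h * p) ^ d) ≤ M := by
  refine le_trans (le_of_eq ?_) hb.le_M
  ring

omit [Fact p.Prime] in
theorem Budget.p_pow_mul_le : p * (h * p) ^ d ≤ M :=
  (Nat.le_mul_of_pos_left _ hb.one_le).trans hb.hp_pow_mul_le

theorem Budget.hp_pow_le : (h * p) ^ d ≤ M :=
  (Nat.le_mul_of_pos_left _ (Fact.out : p.Prime).pos).trans hb.p_pow_mul_le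

theorem Budget.totalDegree_hat_le' {φ : Formula p V} (hφ : φ.depth ≤ d) :
    (hat h ρ φ).totalDegree ≤ (h * p) ^ d :=
  (totalDegree_hat_le hb.one_le φ).trans
    (Nat.pow_le_pow_right (Nat.mul_pos hb.one_le (Fact.out : p.Prime).pos) hφ)

theorem Budget.totalDegree_le_e {f : MvPolynomial V (ZMod p)}
    (hf : f.totalDegree ≤ (h * p) ^ d) : f.totalDegree ≤ e := by
  have := hb.hp_pow_le
  have := hb.le_e
  omega

theorem Budget.totalDegree_hat_le_e {φ : Formula p V} (hφ : φ.depth ≤ d) :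
    (hat h ρ φ).totalDegree ≤ e := hb.totalDegree_le_e (hb.totalDegree_hat_le' hφ)

theorem Budget.totalDegree_linComb {φs : List (Formula p V)} (hφ : (Formula.or φs).depth ≤ d)
    (c : ℕ → ZMod p) :
    (linComb c ((flatAll φs).map (hat h ρ))).totalDegree ≤ (h * p) ^ d := by
  refine totalDegree_linComb_le _ fun f hf => ?_
  obtain ⟨a, ha, rfl⟩ := List.mem_map.1 hf
  exact hb.totalDegree_hat_le' (by have := depth_lt_of_mem_flatAll ha; omega)

theorem Budget.detectable_pow_pred {f : MvPolynomial V (ZMod p)}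
    (hf : f.totalDegree ≤ (h * p) ^ d) :
    Detectable F (e := e) (p * (mulCost p H M + 3)) fun B =>
      val B (f ^ (p - 1)) ≠ val B f ^ (p - 1) := by
  refine (detectable_pow hb.card_le hb.le_e hf (p - 1) ?_).le
    (Nat.mul_le_mul_right _ (Nat.sub_le p 1))
  exact (Nat.mul_le_mul_right _ (Nat.sub_le p 1)).trans hb.p_pow_mul_le

theorem Budget.detectable_one_sub_pow {f : MvPolynomial V (ZMod p)}
    (hf : f.totalDegree ≤ (h * p) ^ d) :
    Detectable F (e := e) (p * (mulCost p H M + 3) + 3 * p + 9) fun B =>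
      val B (1 - f ^ (p - 1)) ≠ 1 - val B f ^ (p - 1) := by
  have hd : (f ^ (p - 1)).totalDegree ≤ e := by
    have h1 := totalDegree_pow_le hf (p - 1)
    have h2 := (Nat.mul_le_mul_right ((h * p) ^ d) (Nat.sub_le p 1)).trans hb.p_pow_mul_le
    have := hb.le_e
    omega
  refine ((hb.detectable_pow_pred hf).cases (detectable_one_sub hd) fun B hB => ?_).le
    (by omega)
  by_contra! hc
  exact hB (by rw [hc.2, hc.1])

variable (ρ) in
/-- The value of the approximation of a `MOD` formula is determined by that of the sum. -/
theorem Budget.detectable_mod {i : ZMod p} {φs : List (Formula p V)}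
    (hφ : (Formula.mod i φs).depth ≤ d) :
    Detectable F (e := e) U fun B => val B (hat h ρ (.mod i φs)) ≠
      1 - (val B ((φs.map (hat h ρ)).sum) - i) ^ (p - 1) := by
  have hs : ((φs.map (hat h ρ)).sum).totalDegree ≤ (h * p) ^ d :=
    totalDegree_list_sum_le _ fun φ hm => hb.totalDegree_hat_le' (by
      have := depth_le_depthMax hm
      rw [depth] at hφ
      omega)
  have hs' : ((φs.map (hat h ρ)).sum - C i).totalDegree ≤ (h * p) ^ d :=
    (totalDegree_sub _ _).trans (max_le hs (by simp))
  refine (((hb.detectable_one_sub_pow hs').or (detectable_sub (hb.totalDegree_le_e hs)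
    (g := C i) (by simp))).cases (detectable_C (k := 0) i) fun B hB => ?_).le
    (by have := hb.cost_mod; omega)
  by_contra! hc
  rw [hat_mod, hc.1.1, hc.1.2, hc.2] at hB
  exact hB rfl

variable (ρ) in
/-- The value of the approximation of a disjunction is determined by those of the linear
combinations. -/
theorem Budget.detectable_or {φs : List (Formula p V)} (hφ : (Formula.or φs).depth ≤ d) :
    Detectable F (e := e) U fun B => val B (hat h ρ (.or φs)) ≠
      1 - ∏ i ∈ Finset.range h,
        (1 - val B (linComb (ρ (.or φs) i) ((flatAll φs).map (hat h ρ))) ^ (p - 1)) := by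
  have hlen : (Finset.range h).toList.length = h := by simp
  set g : ℕ → MvPolynomial V (ZMod p) :=
    fun i => linComb (ρ (.or φs) i) ((flatAll φs).map (hat h ρ)) with hg
  have hd : ∀ i, (g i).totalDegree ≤ (h * p) ^ d := fun i => hb.totalDegree_linComb hφ _
  have hd' : ∀ i, (1 - g i ^ (p - 1)).totalDegree ≤ p * (h * p) ^ d := fun i =>
    totalDegree_one_sub_le ((totalDegree_pow_le (hd i) _).trans
      (Nat.mul_le_mul_right _ (Nat.sub_le p 1)))
  have hprod := detectable_prod (F := F) (e := e) hb.card_le hb.le_e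
    (G := fun i => 1 - g i ^ (p - 1)) (Finset.range h).toList (fun i _ => hd' i)
    (by rw [hlen]; exact hb.hp_pow_mul_le)
  have hdp := totalDegree_list_prod_le (G := fun i => 1 - g i ^ (p - 1))
    (Finset.range h).toList (fun i _ => hd' i)
  rw [hlen] at hprod hdp
  simp only [Finset.prod_map_toList] at hprod hdp
  refine ((hprod.or (detectable_one_sub (f := ∏ i ∈ Finset.range h, (1 - g i ^ (p - 1))) ?_)).cases
    (Detectable.exists_lt h fun i _ => hb.detectable_one_sub_pow (F := F) (hd i)) fun B hB => ?_).le
    (by have := hb.cost_or; simp only [mul_add] at *; omega)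
  · have := hb.hp_pow_mul_le
    have := hb.le_e
    omega
  · by_contra! hc
    rw [hat_or, orApprox, hc.1.2, hc.1.1] at hB
    exact hB (congrArg _ (Finset.prod_congr rfl fun i hi => hc.2 i (Finset.mem_range.1 hi)))

variable (ρ) in
/-- Approximations take the values `0` and `1` only. -/
theorem Budget.detectable_bool {φ : Formula p V} (hφ : φ.depth ≤ d) :
    Detectable F (e := e) (2 * U) fun B =>
      val B (hat h ρ φ) ≠ 0 ∧ val B (hat h ρ φ) ≠ 1 := by
  have hpp : p - 1 ≠ 0 := by have := (Fact.out : p.Prime).two_le; omega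
  have hpow : ∀ x : ZMod p, 1 - x ^ (p - 1) = 0 ∨ 1 - x ^ (p - 1) = 1 := by
    intro x
    rcases eq_or_ne x 0 with rfl | hx
    · exact .inr (by simp [hpp])
    · exact .inl (by rw [ZMod.pow_card_sub_one_eq_one hx, sub_self])
  -- Depth does not bound the length of a chain of negations, so handling them one at a time could
  -- need too many queries. Stripped together they cost one subtraction.
  obtain ⟨ψ, hneg, hd, hψ⟩ := exists_hat_eq (h := h) (ρ := ρ) φ
  have hψd := hd.trans hφ
  have key : Detectable F (e := e) U fun B =>
      val B (hat h ρ ψ) ≠ 0 ∧ val B (hat h ρ ψ) ≠ 1 := by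
    cases ψ with
    | var x =>
      rw [hat_var]
      have h1 := hb.hp_pow_le
      have h2 : 1 ≤ (h * p) ^ d :=
        Nat.one_le_pow _ _ (Nat.mul_pos hb.one_le (Fact.out : p.Prime).pos)
      have := hb.le_e
      exact detectable_X (by omega) x
    | neg ψ => simp [IsNeg] at hneg
    | mod i φs =>
      refine (hb.detectable_mod ρ hψd).imp fun B hB hc => ?_
      rw [hc] at hB
      exact (hpow _).elim hB.1 hB.2
    | or φs =>
      refine (hb.detectable_or ρ hψd).imp fun B hB hc => ?_
      rw [hc] at hB
      have : ∀ s : Finset ℕ, ∀ x : ℕ → ZMod p, ∏ i ∈ s, (1 - x i ^ (p - 1)) = 0 ∨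
          ∏ i ∈ s, (1 - x i ^ (p - 1)) = 1 := by
        intro s x
        refine Finset.prod_induction _ (fun z => z = 0 ∨ z = 1) ?_ (.inr rfl) fun i _ => hpow _
        rintro a b (rfl | rfl) (rfl | rfl) <;> simp
      rcases this (Finset.range h) fun i =>
        val B (linComb (ρ (.or φs) i) ((flatAll φs).map (hat h ρ))) with h1 | h1 <;>
      simp [h1] at hB
  refine (key.cases (detectable_one_sub (f := hat h ρ ψ) (hb.totalDegree_hat_le_e hψd))
    fun B hB => ?_).le (by have := hb.cost_mod; omega)
  rcases hψ with hψ | hψ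
  · rw [hψ] at hB; exact .inl hB
  · by_contra! hc
    rw [hψ, hc.2] at hB
    by_cases h0 : val B (hat h ρ ψ) = 0
    · simp [h0] at hB
    · simp [hc.1 h0] at hB

variable (ρ) in
/-- A formula and its negation have opposite truth values. -/
theorem Budget.detectable_neg {φ : Formula p V} (hφ : φ.depth ≤ d) :
    Detectable F (e := e) (3 * U) fun B => ¬ (Holds h ρ B (.neg φ) ↔ ¬ Holds h ρ B φ) := by
  refine ((hb.detectable_bool ρ hφ).cases (detectable_one_sub (f := hat h ρ φ)
    (hb.totalDegree_hat_le_e hφ)) fun B hB => ?_).le (by have := hb.cost_mod; omega)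
  by_contra! hc
  apply hB
  rw [Holds, Holds, hat_neg, hc.2]
  by_cases h0 : val B (hat h ρ φ) = 0
  · simp [h0]
  · simp [hc.1 h0]

/-- Search for a true disjunct of a true disjunction. -/
theorem Budget.detectable_or_elim {φs : List (Formula p V)} (hφ : (Formula.or φs).depth ≤ d)
    (hL : (flatAll φs).length ≤ 2 ^ L)
    (hk : ∀ a ∈ flatAll φs, Detectable F k fun B => P B ∧ Holds h ρ B a) :
    Detectable F (k + 3 * U) fun B => P B ∧ Holds h ρ B (.or φs) := by
  have hpp : p - 1 ≠ 0 := by have := (Fact.out : p.Prime).two_le; omega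
  set l := (flatAll φs).map (hat h ρ) with hl
  have hlen : l.length = (flatAll φs).length := by simp [hl]
  -- This direction needs no goodness: if all `h` combinations vanish, the approximation is `1 - 1 =
  -- 0`. So a nonvanishing combination is found, and comparing it with a sum of zeros locates a
  -- nonzero summand.
  have h1 : Detectable F (k + (3 * p + 3) + 8 * L + h) fun B => P B ∧ ∃ i < h,
      val B (linComb (ρ (.or φs) i) l) ∉ ({0} : Set (ZMod p)) := by
    refine Detectable.exists_query h (fun i => toLow e (linComb (ρ (.or φs) i) l)) {0}
      fun i _ => ?_
    have hd : ∀ j ∈ (Finset.range l.length).toList, (l.getD j 0).totalDegree ≤ e ∧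
        ∃ a ∈ flatAll φs, hat h ρ a = l.getD j 0 := by
      intro j hj
      rw [Finset.mem_toList, Finset.mem_range] at hj
      rw [List.getD_eq_getElem _ _ hj]
      obtain ⟨a, ha, h2⟩ := List.mem_map.1 (List.getElem_mem hj)
      refine ⟨?_, a, ha, h2⟩
      rw [← h2]
      exact hb.totalDegree_hat_le_e (by have := depth_lt_of_mem_flatAll ha; omega)
    refine (Detectable.sum (k := k + (3 * p + 3)) (P := P)
      (fun j => C (ρ (.or φs) i j) * l.getD j 0) (fun _ => 0) 0 L
      (Finset.range l.length).toList (by simpa [hlen] using hL)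
      (fun j hj => (totalDegree_mul _ _).trans (by simpa using (hd j hj).1)) (by simp)
      fun j hj => ?_).imp fun B hB => ⟨hB.1, ?_⟩
    · obtain ⟨h2, a, ha, h3⟩ := hd j hj
      refine ((hk a ha).cases (detectable_C_mul h2 (ρ (.or φs) i j)) fun B hB => ?_).le (by omega)
      by_contra! hc
      refine hB.2 ?_
      have h0 : val B (l.getD j 0) = 0 := by
        by_contra h0
        exact hc.1 hB.1 (by rwa [Holds, h3])
      rw [hc.2, h0, mul_zero, zero_mul]
    · rw [Finset.sum_map_toList, zero_mul]
      exact hB.2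
  refine (h1.cases (hb.detectable_or ρ hφ) fun B hB => ?_).le
    (by have := hb.cost_search; omega)
  by_contra! hc
  refine hB.2 ?_
  rw [hc.2, Finset.prod_eq_one, sub_self]
  intro i hi
  have : val B (linComb (ρ (.or φs) i) l) = 0 := by
    simpa using hc.1 hB.1 i (Finset.mem_range.1 hi)
  rw [this, zero_pow hpp, sub_zero]

variable (ρ) in
/-- For good coefficients a disjunction with a true disjunct in its outermost block is true. -/
theorem Budget.detectable_flat {φs : List (Formula p V)} (hφ : (Formula.or φs).depth ≤ d)
    (hR : Formula.or φs ∈ R) {a : Formula p V} (ha : a ∈ flatAll φs) :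
    Detectable F (e := e) (3 * U) fun B =>
      Good h ρ R B ∧ Holds h ρ B a ∧ ¬ Holds h ρ B (.or φs) := by
  have had : a.depth ≤ d := by have := depth_lt_of_mem_flatAll ha; omega
  set l := (flatAll φs).map (hat h ρ) with hl
  -- The second alternative in `Good` is a failure of linearity at one of `h * p` explicit
  -- instances, few enough to be checked one by one.
  have h1 : Detectable F (e := e) (h * (p * (3 * p + 6) + 3)) fun B => ∃ i < h, ∃ c : ZMod p,
      val B (linComb (ρ (.or φs) i) l + C c * hat h ρ a) ≠
        val B (linComb (ρ (.or φs) i) l) + c * val B (hat h ρ a) := by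
    refine Detectable.exists_lt h fun i _ => ?_
    have h2 := Detectable.exists_mem (F := F) (e := e) (k := 3 * p + 3)
      (Finset.univ : Finset (ZMod p)).toList
      (P := fun c B => val B (linComb (ρ (.or φs) i) l + C c * hat h ρ a) ≠
        val B (linComb (ρ (.or φs) i) l) + c * val B (hat h ρ a)) fun c _ => ?_
    · simpa [ZMod.card] using h2
    · have hd : (C c * hat h ρ a).totalDegree ≤ e := (totalDegree_mul _ _).trans
        (by simpa using hb.totalDegree_hat_le_e had)
      refine ((detectable_add (k := 0) (hb.totalDegree_le_e (hb.totalDegree_linComb (ρ := ρ) hφ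
        (ρ (.or φs) i))) hd).cases (detectable_C_mul (hb.totalDegree_hat_le_e (ρ := ρ) had) c)
        fun B hB => ?_).le (by omega)
      by_contra! hc
      rw [hl, hc.1, hc.2] at hB
      exact hB rfl
  refine (h1.cases (hb.detectable_or ρ hφ) fun B hB => ?_).le
    (by have := hb.cost_good; have := hb.cost_search; omega)
  obtain ⟨hg, hBa, hBo⟩ := hB
  rcases hg φs hR a ha hBa with ⟨i, hi, hne⟩ | hsh
  · right
    intro hc
    refine hBo fun h0 => ?_
    rw [hc, Finset.prod_eq_zero (Finset.mem_range.2 hi), sub_zero] at h0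
    · exact one_ne_zero h0
    · rw [ZMod.pow_card_sub_one_eq_one hne, sub_self]
  · exact .inl hsh

end Degrees

end Consistency

-- Soundness of the axioms and rules, in detectable form

section Sequents
open MvPolynomial Formula

variable {p : ℕ} {V : Type u}

/-- A set of formulas closed under subformulas, of depth at most `d` and with at most `2 ^ L`
disjuncts in each block of disjunctions. -/
structure Admissible (R : Set (Formula p V)) (L d : ℕ) : Prop extends SubClosed R where
  depth_le : ∀ {φ}, φ ∈ R → φ.depth ≤ d
  length_le : ∀ {φs}, Formula.or φs ∈ R → (flatAll φs).length ≤ 2 ^ L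

variable [Fact p.Prime] [Fintype V] {F : Finset (MvPolynomial V (ZMod p))}
  {h H M L d e U : ℕ} {ρ : Formula p V → ℕ → ℕ → ZMod p} {R : Set (Formula p V)} {k : ℕ}
  {P Q : (LowDeg p V e → ZMod p) → Prop}

section Connectives

variable (hb : Budget p V h H M L d e U) (hR : Admissible R L d)
include hb hR

omit [Fact p.Prime] hR in
theorem Budget.six_le : 6 ≤ U := by have := hb.cost_search; omega

variable (ρ) in
-- Goodness speaks only of members of the flattened block. If `φ` is itself a disjunction, a true
-- member of its block is searched for; that member also belongs to the larger block.
theorem Budget.detectable_or_intro {φs : List (Formula p V)} (ho : Formula.or φs ∈ R)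
    {φ : Formula p V} (hφ : φ ∈ φs) :
    Detectable F (e := e) (6 * U) fun B =>
      Good h ρ R B ∧ Holds h ρ B φ ∧ ¬ Holds h ρ B (.or φs) := by
  have hd := hR.depth_le ho
  have hm := hR.or ho φ hφ
  rcases hor : φ.IsOr with _ | _
  · refine (hb.detectable_flat ρ hd ho (mem_flatAll.2 ⟨φ, hφ, ?_⟩)).le (by omega)
    rw [flat_of_not_isOr hor]; simp
  · cases φ with
    | or ψs =>
      refine (hb.detectable_or_elim (ρ := ρ) (k := 3 * U)
        (P := fun B => Good h ρ R B ∧ ¬ Holds h ρ B (.or φs)) (hR.depth_le hm)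
        (hR.length_le hm) fun a ha => ?_).mono (fun B hB => ⟨⟨hB.1, hB.2.2⟩, hB.2.1⟩) (by omega)
      refine (hb.detectable_flat ρ hd ho (a := a) (mem_flatAll.2 ⟨_, hφ, ?_⟩)).imp
        fun B hB => ⟨hB.1.1, hB.2, hB.1.2⟩
      rwa [flat]
    | _ => simp [IsOr] at hor

/-- The search returns a member of the flattened block, possibly buried in a disjunct that is itself
a disjunction. Goodness at the inner disjunction makes that disjunct true, so `hk` applies to it. -/
theorem Budget.detectable_or_cases {φs : List (Formula p V)} (ho : Formula.or φs ∈ R)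
    (hP : ∀ B, P B → Good h ρ R B)
    (hk : ∀ φ ∈ φs, Detectable F k fun B => P B ∧ Holds h ρ B φ) :
    Detectable F (k + 7 * U) fun B => P B ∧ Holds h ρ B (.or φs) := by
  have h6 := hb.six_le
  refine (hb.detectable_or_elim (k := k + 4 * U) (P := P) (hR.depth_le ho) (hR.length_le ho)
    fun a ha => ?_).le (by omega)
  obtain ⟨φ, hφ, ha⟩ := mem_flatAll.1 ha
  have hm := hR.or ho φ hφ
  rcases hor : φ.IsOr with _ | _
  · rw [flat_of_not_isOr hor, List.mem_singleton] at ha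
    exact ha ▸ (hk φ hφ).le (by omega)
  · cases φ with
    | or ψs =>
      rw [flat] at ha
      refine ((hk _ hφ).cases (hb.detectable_flat ρ (hR.depth_le hm) hm ha) fun B hB => ?_).le
        (by omega)
      by_cases hh : Holds h ρ B (.or ψs)
      · exact .inl ⟨hB.1, hh⟩
      · exact .inr ⟨hP B hB.1, hB.2, hh⟩
    | _ => simp [IsOr] at hor

theorem Budget.detectable_and_elim {φs : List (Formula p V)} (ho : Formula.and φs ∈ R)
    {φ : Formula p V} (hφ : φ ∈ φs) :
    Detectable F (e := e) (14 * U) fun B =>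
      Good h ρ R B ∧ ¬ Holds h ρ B φ ∧ Holds h ρ B (.and φs) := by
  have h6 := hb.six_le
  have ho' := hR.neg ho
  have hm := hR.or ho' (.neg φ) (List.mem_map_of_mem hφ)
  refine (((hb.detectable_or_intro ρ hR ho' (List.mem_map_of_mem hφ)).or (hb.detectable_neg ρ
    (hR.depth_le ho'))).cases (hb.detectable_neg ρ (hR.depth_le (hR.neg hm))) fun B hB => ?_).le
    (by omega)
  rw [Formula.and] at hB
  tauto

theorem Budget.detectable_and_intro {φs : List (Formula p V)} (ho : Formula.and φs ∈ R)
    (hP : ∀ B, P B → Good h ρ R B)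
    (hk : ∀ φ ∈ φs, Detectable F k fun B => P B ∧ ¬ Holds h ρ B φ) :
    Detectable F (k + 15 * U) fun B => P B ∧ ¬ Holds h ρ B (.and φs) := by
  have h6 := hb.six_le
  have ho' := hR.neg ho
  refine ((hb.detectable_or_cases hR (k := k + 4 * U) ho' hP fun χ hχ => ?_).cases
    (hb.detectable_neg ρ (hR.depth_le ho')) fun B hB => ?_).le (by omega)
  · obtain ⟨φ, hφ, rfl⟩ := List.mem_map.1 hχ
    have hm := hR.or ho' (.neg φ) hχ
    refine ((hk φ hφ).cases (hb.detectable_neg ρ (hR.depth_le (hR.neg hm))) fun B hB => ?_).le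
      (by omega)
    tauto
  · rw [Formula.and] at hB
    tauto

variable (ρ) in
theorem Budget.detectable_or_pair {φ ψ : Formula p V} (ho : Formula.or [φ, ψ] ∈ R) :
    Detectable F (e := e) (23 * U) fun B => Good h ρ R B ∧
      ¬ (Holds h ρ B (.or [φ, ψ]) ↔ Holds h ρ B φ ∨ Holds h ρ B ψ) := by
  have h6 := hb.six_le
  refine (((hb.detectable_or_intro ρ hR ho (φ := φ) (by simp)).or
    (hb.detectable_or_intro ρ hR ho (φ := ψ) (by simp))).cases
    (hb.detectable_or_cases hR (k := 0) (ρ := ρ) ho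
      (P := fun B => Good h ρ R B ∧ ¬ (Holds h ρ B φ ∨ Holds h ρ B ψ)) (fun B hB => hB.1)
      fun χ hχ => detectable_of_false fun B hB => ?_) fun B hB => ?_).le (by omega)
  · rcases List.mem_pair.1 hχ with rfl | rfl <;> tauto
  · tauto

variable (ρ) in
theorem Budget.detectable_and_pair {φ ψ : Formula p V} (ho : Formula.and [φ, ψ] ∈ R) :
    Detectable F (e := e) (46 * U) fun B => Good h ρ R B ∧
      ¬ (Holds h ρ B (.and [φ, ψ]) ↔ Holds h ρ B φ ∧ Holds h ρ B ψ) := by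
  have h6 := hb.six_le
  refine (((hb.detectable_and_elim hR (ρ := ρ) ho (φ := φ) (by simp)).or
    (hb.detectable_and_elim hR (ρ := ρ) ho (φ := ψ) (by simp))).cases
    (hb.detectable_and_intro hR (k := 0) (ρ := ρ) ho
      (P := fun B => Good h ρ R B ∧ (Holds h ρ B φ ∧ Holds h ρ B ψ)) (fun B hB => hB.1)
      fun χ hχ => detectable_of_false fun B hB => ?_) fun B hB => ?_).le (by omega)
  · rcases List.mem_pair.1 hχ with rfl | rfl <;> tauto
  · tauto

variable (ρ) in
omit hR in
theorem Budget.detectable_mod_iff {i : ZMod p} {φs : List (Formula p V)}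
    (hd : (Formula.mod i φs).depth ≤ d) :
    Detectable F (e := e) U fun B =>
      ¬ (Holds h ρ B (.mod i φs) ↔ val B ((φs.map (hat h ρ)).sum) = i) := by
  have hpp : p - 1 ≠ 0 := by have := (Fact.out : p.Prime).two_le; omega
  refine (hb.detectable_mod ρ hd).imp fun B hB hc => hB ?_
  rw [Holds, hc]
  rcases eq_or_ne (val B ((φs.map (hat h ρ)).sum)) i with h0 | h0
  · simp [h0, hpp]
  · simp [h0, ZMod.pow_card_sub_one_eq_one (sub_ne_zero.2 h0)]

/-- The `MOD` axioms are true. -/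
theorem Budget.detectable_modAxiom {φ : Formula p V} (hφ : IsModAxiom φ) (hm : φ ∈ R) :
    Detectable F (e := e) (250 * U) fun B => Good h ρ R B ∧ ¬ Holds h ρ B φ := by
  have h6 := hb.six_le
  cases hφ with
  | empty_zero =>
    refine ((hb.detectable_mod_iff ρ (hR.depth_le hm)).cases (detectable_zero (k := 0))
      fun B hB => ?_).le (by omega)
    simp only [List.map_nil, List.sum_nil]
    tauto
  | empty_ne i hi =>
    refine (((hb.detectable_mod_iff ρ (hR.depth_le (hR.neg hm))).or
      (detectable_zero (k := 0))).cases (hb.detectable_neg ρ (hR.depth_le (hR.neg hm)))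
      fun B hB => ?_).le (by omega)
    simp only [List.map_nil, List.sum_nil]
    by_contra! hc
    have h0 := hc.1.2
    rw [h0] at hc
    exact hi.symm (hc.1.1.1 (by tauto))
  | step i Γ φ =>
    have hm1 := hR.or (hR.neg hm) (.neg (.or [.neg (.mod i (Γ ++ [φ])),
      .or [.and [.mod i Γ, .neg φ], .and [.mod (i - 1) Γ, φ]]])) (by simp)
    have hm2 := hR.or (hR.neg hm) (.neg (.or [.neg (.or [.and [.mod i Γ, .neg φ],
      .and [.mod (i - 1) Γ, φ]]), .mod i (Γ ++ [φ])])) (by simp)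
    have hX := hR.or (hR.neg hm2) (.mod i (Γ ++ [φ])) (by simp)
    have hY := hR.or (hR.neg hm1) (.or [.and [.mod i Γ, .neg φ], .and [.mod (i - 1) Γ, φ]])
      (by simp)
    have hA1 := hR.or hY (.and [.mod i Γ, .neg φ]) (by simp)
    have hA2 := hR.or hY (.and [.mod (i - 1) Γ, φ]) (by simp)
    have hM1 := hR.neg (hR.or (hR.neg hA1) (.neg (.mod i Γ)) (by simp))
    have hM2 := hR.neg (hR.or (hR.neg hA2) (.neg (.mod (i - 1) Γ)) (by simp))
    have hφ := hR.mod hX φ (by simp)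
    have hΓ : ((Γ.map (hat h ρ)).sum).totalDegree ≤ e :=
      totalDegree_list_sum_le Γ fun ψ hψ =>
        hb.totalDegree_hat_le_e (hR.depth_le (hR.mod hX ψ (by simp [hψ])))
    -- Fourteen local laws evaluate the axiom from its parts. If none of them fails, only the
    -- recursion for sums modulo `p` in `key` remains, and it splits on whether `φ` contributes `0`
    -- or `1`.
    refine ((((((((((((((hb.detectable_and_pair ρ hR hm).or
      (hb.detectable_or_pair ρ hR (hR.neg hm1))).or
      (hb.detectable_or_pair ρ hR (hR.neg hm2))).or
      (hb.detectable_neg ρ (hR.depth_le hX))).or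
      (hb.detectable_neg ρ (hR.depth_le hY))).or
      (hb.detectable_or_pair ρ hR hY)).or
      (hb.detectable_and_pair ρ hR hA1)).or
      (hb.detectable_neg ρ (hR.depth_le hφ))).or
      (hb.detectable_and_pair ρ hR hA2)).or
      (hb.detectable_mod_iff ρ (hR.depth_le hX))).or
      (hb.detectable_mod_iff ρ (hR.depth_le hM1))).or
      (hb.detectable_mod_iff ρ (hR.depth_le hM2))).or
      (hb.detectable_bool ρ (hR.depth_le hφ))).cases
      (detectable_add (k := 0) hΓ (hb.totalDegree_hat_le_e (ρ := ρ) (hR.depth_le hφ)))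
      fun B hB => ?_).le (by omega)
    obtain ⟨hG, hB⟩ := hB
    rw [Formula.iff] at hB
    by_contra hc
    simp only [not_or, hG, true_and, not_not, List.map_append, List.sum_append, List.map_cons,
      List.map_nil, List.sum_cons, List.sum_nil, add_zero] at hc
    obtain ⟨⟨⟨⟨⟨⟨⟨⟨⟨⟨⟨⟨⟨c1, c2⟩, c3⟩, c4⟩, c5⟩, c6⟩, c7⟩, c8⟩, c9⟩, c10⟩, c11⟩, c12⟩, c13⟩, c14⟩ := hc
    have key : Holds h ρ B (.mod i (Γ ++ [φ])) ↔ (Holds h ρ B (.mod i Γ) ∧ ¬ Holds h ρ B φ) ∨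
        (Holds h ρ B (.mod (i - 1) Γ) ∧ Holds h ρ B φ) := by
      rw [c10, c11, c12, c14]
      by_cases h0 : val B (hat h ρ φ) = 0
      · simp [Holds, h0]
      · have h1 : val B (hat h ρ φ) = 1 := by
          by_contra h1
          exact c13 ⟨h0, h1⟩
        simp [Holds, h1, eq_sub_iff_add_eq]
    apply hB
    rw [c1, c2, c3, c4, c5, c6, c7, c8, c9, key]
    exact ⟨(Classical.em _).symm, (Classical.em _).symm⟩

end Connectives

/-- The disjunction expressing a sequent. -/
def Sequent.toFormula (S : Sequent p V) : Formula p V := .or (S.ante.map .neg ++ S.succ)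

section Rules

variable (hb : Budget p V h H M L d e U) (hR : Admissible R L d)
include hb hR

omit hb [Fact p.Prime] [Fintype V] in
theorem Admissible.mem_of_ante {S : Sequent p V} (hS : S.toFormula ∈ R) {φ : Formula p V}
    (hφ : φ ∈ S.ante) : φ ∈ R :=
  hR.neg (hR.or hS (.neg φ) (by simp [hφ]))

omit hb [Fact p.Prime] [Fintype V] in
theorem Admissible.mem_of_succ {S : Sequent p V} (hS : S.toFormula ∈ R) {φ : Formula p V}
    (hφ : φ ∈ S.succ) : φ ∈ R :=
  hR.or hS φ (by simp [hφ])

theorem Budget.detectable_of_ante {S : Sequent p V} (hS : S.toFormula ∈ R)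
    (hP : ∀ B, P B → Good h ρ R B ∧ ¬ Holds h ρ B S.toFormula) {φ : Formula p V}
    (hφ : φ ∈ S.ante) : Detectable F (10 * U) fun B => P B ∧ ¬ Holds h ρ B φ := by
  have h6 := hb.six_le
  refine ((hb.detectable_or_intro ρ hR hS (φ := .neg φ) (by simp [hφ])).cases
    (hb.detectable_neg ρ (hR.depth_le (hR.mem_of_ante hS hφ))) fun B hB => ?_).le (by omega)
  have := hP B hB.1
  rw [Sequent.toFormula] at this
  tauto

theorem Budget.detectable_of_succ {S : Sequent p V} (hS : S.toFormula ∈ R)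
    (hP : ∀ B, P B → Good h ρ R B ∧ ¬ Holds h ρ B S.toFormula) {φ : Formula p V}
    (hφ : φ ∈ S.succ) : Detectable F (10 * U) fun B => P B ∧ Holds h ρ B φ := by
  refine (hb.detectable_or_intro ρ hR hS (φ := φ) (by simp [hφ])).mono (fun B hB => ?_) (by omega)
  have := hP B hB.1
  exact ⟨this.1, hB.2, this.2⟩

/-- Use of a true sequent. -/
theorem Budget.detectable_of_sequent {S : Sequent p V} (hS : S.toFormula ∈ R)
    (hP : ∀ B, P B → Good h ρ R B)
    (h0 : Detectable F (10 * U) fun B => P B ∧ ¬ Holds h ρ B S.toFormula)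
    (h1 : ∀ φ ∈ S.ante, Detectable F k fun B => P B ∧ ¬ Holds h ρ B φ)
    (h2 : ∀ φ ∈ S.succ, Detectable F k fun B => P B ∧ Holds h ρ B φ) :
    Detectable F (k + 22 * U) P := by
  have h6 := hb.six_le
  refine ((hb.detectable_or_cases hR (k := k + 4 * U) hS hP fun χ hχ => ?_).cases h0
    fun B hB => ?_).le (by omega)
  · rcases List.mem_append.1 hχ with hχ | hχ
    · obtain ⟨φ, hφ, rfl⟩ := List.mem_map.1 hχ
      refine ((h1 φ hφ).cases (hb.detectable_neg ρ (hR.depth_le (hR.mem_of_ante hS hφ)))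
        fun B hB => ?_).le (by omega)
      tauto
    · exact (h2 χ hχ).le (by omega)
  · rw [Sequent.toFormula]
    tauto

/-- A false sequent is not inferred from true ones. -/
theorem Budget.detectable_infer {A : Set (Formula p V)} {T : Sequent p V → Prop}
    {S : Sequent p V} (hS : S.toFormula ∈ R)
    (hP : ∀ B, P B → Good h ρ R B ∧ ¬ Holds h ρ B S.toFormula)
    (hA : ∀ φ ∈ A, φ ∈ R → Detectable F (e := e) (k * U) fun B => Good h ρ R B ∧ ¬ Holds h ρ B φ)
    (hT : ∀ S', T S' → S'.toFormula ∈ R)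
    (hT' : ∀ S', T S' → Detectable F (10 * U) fun B => P B ∧ ¬ Holds h ρ B S'.toFormula)
    (hi : Infer A T S) : Detectable F ((k + 300) * U) P := by
  have h6 := hb.six_le
  have ante : ∀ φ ∈ S.ante, Detectable F (10 * U) fun B => P B ∧ ¬ Holds h ρ B φ :=
    fun φ => hb.detectable_of_ante hR hS hP
  have succ : ∀ φ ∈ S.succ, Detectable F (10 * U) fun B => P B ∧ Holds h ρ B φ :=
    fun φ => hb.detectable_of_succ hR hS hP
  -- Falsity of `S` fixes the truth values of all its formulas, so a premise built from these
  -- formulas alone would be false too. `left` and `right` allow one extra formula in the premise;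
  -- `Q` carries what is assumed about it.
  have sub : ∀ S', T S' → S'.ante ⊆ S.ante → S'.succ ⊆ S.succ → Detectable F (32 * U) P :=
    fun S' h' h1 h2 => (hb.detectable_of_sequent hR (k := 10 * U) (hT S' h') (fun B hB => (hP B hB).1)
      (hT' S' h') (fun φ hφ => ante φ (h1 hφ)) fun φ hφ => succ φ (h2 hφ)).le (by omega)
  have left : ∀ S' φ Q, T S' → (∀ B, Q B → P B) → S'.ante ⊆ φ :: S.ante → S'.succ ⊆ S.succ →
      Detectable F (20 * U) (fun B => Q B ∧ ¬ Holds h ρ B φ) → Detectable F (42 * U) Q := by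
    intro S' φ Q h' hQ h1 h2 h3
    refine (hb.detectable_of_sequent hR (k := 20 * U) (hT S' h') (fun B hB => (hP B (hQ B hB)).1)
      ((hT' S' h').imp fun B hB => ⟨hQ B hB.1, hB.2⟩) (fun ψ hψ => ?_) fun ψ hψ => ?_).le (by omega)
    · rcases List.mem_cons.1 (h1 hψ) with rfl | hψ
      · exact h3
      · exact (ante ψ hψ).mono (fun B hB => ⟨hQ B hB.1, hB.2⟩) (by omega)
    · exact (succ ψ (h2 hψ)).mono (fun B hB => ⟨hQ B hB.1, hB.2⟩) (by omega)
  have right : ∀ S' φ Q, T S' → (∀ B, Q B → P B) → S'.ante ⊆ S.ante → S'.succ ⊆ φ :: S.succ →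
      Detectable F (20 * U) (fun B => Q B ∧ Holds h ρ B φ) → Detectable F (42 * U) Q := by
    intro S' φ Q h' hQ h1 h2 h3
    refine (hb.detectable_of_sequent hR (k := 20 * U) (hT S' h') (fun B hB => (hP B (hQ B hB)).1)
      ((hT' S' h').imp fun B hB => ⟨hQ B hB.1, hB.2⟩) (fun ψ hψ => ?_) fun ψ hψ => ?_).le (by omega)
    · exact (ante ψ (h1 hψ)).mono (fun B hB => ⟨hQ B hB.1, hB.2⟩) (by omega)
    · rcases List.mem_cons.1 (h2 hψ) with rfl | hψ
      · exact h3
      · exact (succ ψ hψ).mono (fun B hB => ⟨hQ B hB.1, hB.2⟩) (by omega)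
  rw [add_mul]
  have em : ∀ B φ, P B → (P B ∧ ¬ Holds h ρ B φ) ∨ (P B ∧ Holds h ρ B φ) := fun B φ hB =>
    (Classical.em (Holds h ρ B φ)).elim (fun hh => .inr ⟨hB, hh⟩) fun hh => .inl ⟨hB, hh⟩
  cases hi with
  | init φ => exact ((ante φ (by simp)).cases (succ φ (by simp)) fun B => em B φ).le (by omega)
  | modAxiom φ hφ =>
    exact ((hb.detectable_modAxiom hR hφ (hR.mem_of_succ hS (by simp))).cases (succ φ (by simp))
      fun B hB => (em B φ hB).imp_left fun hc => ⟨(hP B hB).1, hc.2⟩).le (by omega)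
  | nonlogical φ hφ =>
    exact ((hA φ hφ (hR.mem_of_succ hS (by simp))).cases (succ φ (by simp))
      fun B hB => (em B φ hB).imp_left fun hc => ⟨(hP B hB).1, hc.2⟩).le (by omega)
  | weakLeft φ Γ Δ h' => exact (sub _ h' (by simp) (by simp)).le (by omega)
  | weakRight φ Γ Δ h' => exact (sub _ h' (by simp) (by simp)).le (by omega)
  | contrLeft φ Γ Δ h' => exact (sub _ h' (by simp) (by simp)).le (by omega)
  | contrRight φ Γ Δ h' => exact (sub _ h' (by simp) (by simp)).le (by omega)
  | exchange Γ Γ' Δ Δ' hΓ hΔ h' => exact (sub _ h' hΓ.subset hΔ.subset).le (by omega)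
  | cut φ Γ Δ h1 h2 =>
    exact ((right _ φ (fun B => P B ∧ ¬ Holds h ρ B φ) h1 (fun B hB => hB.1) (by simp) (by simp)
      (detectable_of_false fun B hB => hB.1.2 hB.2)).cases
      (left _ φ (fun B => P B ∧ Holds h ρ B φ) h2 (fun B hB => hB.1) (by simp) (by simp)
      (detectable_of_false fun B hB => hB.2 hB.1.2)) fun B => em B φ).le (by omega)
  | negLeft φ Γ Δ h' =>
    refine (right _ φ P h' (fun B => id) (by simp) (by simp) ?_).le (by omega)
    exact ((ante (.neg φ) (by simp)).cases (hb.detectable_neg ρ (φ := φ) (hR.depth_le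
      (hR.mem_of_succ (hT _ h') (by simp)))) fun B hB =>
        (em B (.neg φ) hB.1).imp_right fun hc hh => hh.1 hc.2 hB.2).le (by omega)
  | negRight φ Γ Δ h' =>
    refine (left _ φ P h' (fun B => id) (by simp) (by simp) ?_).le (by omega)
    exact ((succ (.neg φ) (by simp)).cases (hb.detectable_neg ρ (φ := φ) (hR.depth_le
      (hR.mem_of_ante (hT _ h') (by simp)))) fun B hB =>
        (em B (.neg φ) hB.1).symm.imp_right fun hc hh => hc.2 (hh.2 hB.2)).le (by omega)
  | orLeft φs Γ Δ h' =>
    have hm : Formula.or φs ∈ R := hR.mem_of_ante hS (by simp)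
    -- The number of premises is unbounded, but the principal disjunction is true, so a true
    -- disjunct is searched for and only its premise is used.
    refine ((hb.detectable_or_cases hR (k := 42 * U) hm (fun B hB => (hP B hB).1)
      fun φ hφ => ?_).cases (ante (.or φs) (by simp)) fun B hB => (em B (.or φs) hB).symm).le
      (by omega)
    exact left _ φ _ (h' φ hφ) (fun B hB => hB.1) (by simp) (by simp)
      (detectable_of_false fun B hB => hB.2 hB.1.2)
  | orRight φs φ Γ Δ hφ h' =>
    have hm : Formula.or φs ∈ R := hR.mem_of_succ hS (by simp)
    refine (right _ φ P h' (fun B => id) (by simp) (by simp) ?_).le (by omega)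
    exact ((hb.detectable_or_intro ρ hR hm hφ).cases (succ (.or φs) (by simp)) fun B hB =>
      (em B (.or φs) hB.1).imp_left fun hc => ⟨(hP B hB.1).1, hB.2, hc.2⟩).le (by omega)

end Rules

end Sequents

-- Truth of the system's equations, and the search through a refutation

section Refutations
open MvPolynomial Formula

variable {p : ℕ} {V : Type u}

theorem support_sum_single_one (a : Finset V) :
    (∑ j ∈ a, Finsupp.single j 1 : V →₀ ℕ).support = a := by
  classical
  ext i
  rw [Finsupp.mem_support_iff, Finsupp.finsetSum_apply]
  simp [Finsupp.single_apply]

/-- Both polynomials have the same multilinear representative, so the equality holds for every `B`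
without any query. -/
theorem val_monomial {e : ℕ} (B : LowDeg p V e → ZMod p) {m : V →₀ ℕ} (hm : m.degree ≤ e) :
    val B (monomial m 1) = val B (∏ x ∈ m.support, X x) := by
  have hp : ∏ x ∈ m.support, X x =
      monomial (∑ i ∈ m.support, Finsupp.single i 1) (1 : ZMod p) := mono_eq_monomial _
  have hle : ∑ i ∈ m.support, Finsupp.single i 1 ≤ m := by
    classical
    intro i
    by_cases hi : m i = 0
    · have : i ∉ (∑ j ∈ m.support, Finsupp.single j 1 : V →₀ ℕ).support := by
        rw [support_sum_single_one]; simpa using hi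
      rw [Finsupp.notMem_support_iff.1 this]
      exact Nat.zero_le _
    · exact (sum_single_one_apply_le _ _).trans (Nat.one_le_iff_ne_zero.2 hi)
  have hd := Finsupp.degree_mono hle
  rw [val, val, hp]
  congr 1
  apply Subtype.ext
  rw [coe_toLow ((totalDegree_monomial_le _ _).trans hm),
    coe_toLow ((totalDegree_monomial_le _ _).trans (hd.trans hm)), multilin_eq_multilinMap,
    multilin_eq_multilinMap, multilinMap_monomial, multilinMap_monomial, support_sum_single_one]

/-- The formula saying that one of the first `i` sequents is false. -/
def prefixFormula (π : List (Sequent p V)) (i : ℕ) : Formula p V :=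
  .or ((π.take i).map fun S => .neg S.toFormula)

variable [Fact p.Prime] [Fintype V] {F : Finset (MvPolynomial V (ZMod p))}
  {h H M L d e U : ℕ} {ρ : Formula p V → ℕ → ℕ → ZMod p} {R : Set (Formula p V)} {k : ℕ}

variable (hb : Budget p V h H M L d e U) (hR : Admissible R L d)
include hb hR

omit hR [Fact p.Prime] in
theorem Budget.mulCost_le : mulCost p H M + 3 ≤ U := by
  have h1 := Nat.mul_le_mul_right (mulCost p H M + 3) hb.one_le
  have h2 := hb.cost_or
  omega

/-- If the variables take values in `0, 1` and products are respected, the value of the monomial is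
`1` exactly when all its variables are true, which is also when the conjunction is. The degree is
bounded by a constant in the application, so a cost linear in `D` is affordable. -/
theorem Budget.detectable_monomial {m : V →₀ ℕ}
    (hm : Formula.and (m.support.toList.map .var) ∈ R) {D : ℕ} (hD : m.degree ≤ D) (hDM : D ≤ M) :
    Detectable F (e := e) ((17 * D + 20) * U) fun B => Good h ρ R B ∧
      val B (hat h ρ (.and (m.support.toList.map .var))) ≠ val B (monomial m 1) := by
  have h6 := hb.six_le
  have hmc := hb.mulCost_le
  have he := hb.le_e
  have hcard : m.support.toList.length ≤ D := by
    rw [Finset.length_toList]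
    refine le_trans ?_ hD
    rw [Finset.card_eq_sum_ones]
    exact Finset.sum_le_sum fun i hi => Nat.one_le_iff_ne_zero.2 (Finsupp.mem_support_iff.1 hi)
  have hprod := detectable_prod (F := F) (e := e) hb.card_le hb.le_e (M₀ := 1)
    (G := fun x => X x) m.support.toList (fun x _ => by rw [totalDegree_X]) (by omega)
  simp only [Finset.prod_map_toList] at hprod
  have hvar : Detectable F (e := e) (m.support.toList.length * (0 + 3)) fun B =>
      ∃ x ∈ m.support.toList, val B (X x) ≠ 0 ∧ val B (X x) ≠ 1 := by
    refine Detectable.exists_mem _ fun x hx => detectable_X ?_ x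
    have := List.length_pos_of_mem hx
    omega
  have helim : Detectable F (e := e) (m.support.toList.length * (14 * U + 3)) fun B =>
      ∃ x ∈ m.support.toList, Good h ρ R B ∧ ¬ Holds h ρ B (.var x) ∧
        Holds h ρ B (.and (m.support.toList.map .var)) :=
    Detectable.exists_mem _ fun x hx => hb.detectable_and_elim hR hm (List.mem_map_of_mem hx)
  have hintro := hb.detectable_and_intro (F := F) hR (k := 0) (ρ := ρ) hm
    (P := fun B => Good h ρ R B ∧ ∀ x ∈ m.support.toList, Holds h ρ B (.var x))
    (fun B hB => hB.1) fun χ hχ => detectable_of_false fun B hB => by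
      obtain ⟨x, hx, rfl⟩ := List.mem_map.1 hχ
      exact hB.2 (hB.1.2 x hx)
  refine ((((hprod.or hvar).or helim).or hintro).cases (hb.detectable_bool ρ (hR.depth_le hm))
    fun B hB => ?_).le ?_
  · by_contra hc
    simp only [not_or, not_exists, not_and, not_not, hB.1, true_implies] at hc
    obtain ⟨⟨⟨⟨c1, c2⟩, c3⟩, c4⟩, c5⟩ := hc
    refine hB.2 ?_
    rw [val_monomial B (by omega), c1]
    by_cases h0 : Holds h ρ B (.and (m.support.toList.map .var))
    · rw [c5 h0, Finset.prod_eq_one]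
      intro x hx
      refine c2 x (Finset.mem_toList.2 hx) fun hv => ?_
      exact c3 x (Finset.mem_toList.2 hx) (fun hh => hh (by rw [hat_var]; exact hv)) h0
    · obtain ⟨x, hx, hv⟩ : ∃ x ∈ m.support.toList, ¬ Holds h ρ B (.var x) := by
        by_contra! hcon
        exact h0 (c4 ⟨trivial, hcon⟩)
      rw [not_not.1 h0, Finset.prod_eq_zero (Finset.mem_toList.1 hx)]
      rw [Holds, hat_var] at hv
      exact not_not.1 hv
  · have h1 := Nat.mul_le_mul hcard hmc
    have h2 : m.support.toList.length * (0 + 3) ≤ D * U := Nat.mul_le_mul hcard (by omega)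
    have h3 : m.support.toList.length * (14 * U + 3) ≤ D * (15 * U) :=
      Nat.mul_le_mul hcard (by omega)
    have h4 : D * (15 * U) = 15 * (D * U) := by ring
    have h5 : (17 * D + 20) * U = 17 * (D * U) + 20 * U := by ring
    omega

/-- The formulas that express the equations of the system are true. -/
theorem Budget.detectable_eqFormula {f : MvPolynomial V (ZMod p)} (hf : f ∈ F) {D : ℕ}
    (hD : f.totalDegree ≤ D) (hDM : D ≤ M) (hm : eqFormula f ∈ R) :
    Detectable F (e := e) ((17 * D + 30) * U) fun B =>
      Good h ρ R B ∧ ¬ Holds h ρ B (eqFormula f) := by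
  have h6 := hb.six_le
  have hmc := hb.mulCost_le
  have he := hb.le_e
  have hcost := hb.cost_search
  set ψ : (V →₀ ℕ) → Formula p V := fun m => .and (m.support.toList.map .var) with hψ
  have hψR : ∀ m ∈ f.support, ψ m ∈ R := by
    intro m hs
    refine hR.mod hm _ (List.mem_flatMap.2 ⟨m, Finset.mem_toList.2 hs, ?_⟩)
    rw [List.mem_replicate]
    exact ⟨fun h0 => mem_support_iff.1 hs ((ZMod.val_eq_zero _).1 h0), rfl⟩
  -- Repeating a conjunction as often as its coefficient demands makes the sum inside the `MOD`
  -- formula a copy of `f`, with conjunctions in place of monomials.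
  have hsum : ((f.support.toList.flatMap fun m =>
      List.replicate (f.coeff m).val (Formula.and (m.support.toList.map .var))).map (hat h ρ)).sum =
      (f.support.toList.map fun m => C (f.coeff m) * hat h ρ (ψ m)).sum := by
    induction f.support.toList with
    | nil => rfl
    | cons m s ih =>
      rw [List.flatMap_cons, List.map_append, List.sum_append, ih, List.map_cons, List.sum_cons,
        List.map_replicate, List.sum_replicate, nsmul_eq_mul,
        ← map_natCast (C (σ := V) (R := ZMod p)), ZMod.natCast_zmod_val]
  have hmono : (f.support.toList.map fun m => monomial m (f.coeff m)).sum = f := by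
    rw [Finset.sum_map_toList, support_sum_monomial_coeff]
  have hdeg : ∀ m ∈ f.support.toList, m.degree ≤ D := fun m hs =>
    (le_totalDegree (Finset.mem_toList.1 hs)).trans hD
  have hdm : ∀ m ∈ f.support.toList, ∀ c : ZMod p, (monomial m c).totalDegree ≤ e :=
    fun m hs c => (totalDegree_monomial_le _ _).trans ((hdeg m hs).trans (by omega))
  have hsearch := Detectable.sum (F := F) (e := e) (k := (17 * D + 24) * U)
    (P := Good h ρ R) (fun m => C (f.coeff m) * hat h ρ (ψ m))
    (fun m => monomial m (f.coeff m)) 1 (H * M) f.support.toList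
    (by simpa using card_support_le hb.card_le (hD.trans hDM))
    (fun m hs => (totalDegree_mul _ _).trans (by
      simpa using hb.totalDegree_hat_le_e (hR.depth_le (hψR m (Finset.mem_toList.1 hs)))))
    (fun m hs => hdm m hs _) fun m hs => ?_
  · rw [hmono] at hsearch
    refine ((hsearch.or (hb.detectable_mod_iff ρ (hR.depth_le hm))).cases
      (detectable_eqn (k := 0) hf (by omega)) fun B hB => ?_).le ?_
    · by_contra! hc
      rw [hsum] at hc
      refine hB.2 (hc.1.2.2 ?_)
      rw [hc.1.1 hB.1, hc.2, mul_zero]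
    · have h1 : 8 * (H * M) ≤ U := by unfold mulCost at hmc; omega
      have h2 : (17 * D + 30) * U = (17 * D + 24) * U + 6 * U := by ring
      omega
  · have hψm := hψR m (Finset.mem_toList.1 hs)
    refine (((hb.detectable_monomial (ρ := ρ) hR hψm (hdeg m hs) hDM).or
      (detectable_C_mul (hb.totalDegree_hat_le_e (ρ := ρ) (hR.depth_le hψm)) (f.coeff m))).cases
      (detectable_C_mul (hdm m hs 1) (f.coeff m)) fun B hB => ?_).le ?_
    · by_contra! hc
      refine hB.2 ?_
      rw [hc.1.2, hc.1.1 hB.1, one_mul, ← hc.2, C_mul_monomial, mul_one]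
    · have h2 : (17 * D + 24) * U = (17 * D + 20) * U + 4 * U := by ring
      omega

/-- For good coefficients, an error is found by searching a refutation for a false sequent that is
inferred from true ones. -/
theorem Budget.detectable_good {d₀ : ℕ} {A : Set (Formula p V)} {π : List (Sequent p V)}
    (hπ : IsRefutation d₀ A π) (hπR : ∀ i ≤ π.length, prefixFormula π i ∈ R)
    (hlen : π.length ≤ 2 ^ L)
    (hA : ∀ φ ∈ A, φ ∈ R → Detectable F (e := e) (k * U) fun B => Good h ρ R B ∧ ¬ Holds h ρ B φ) :
    Detectable F (e := e) ((k + 400) * U) (Good h ρ R) := by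
  have h6 := hb.six_le
  have hcost := hb.cost_search
  have hmemR : ∀ S ∈ π, Formula.neg S.toFormula ∈ R := fun S hS =>
    hR.or (hπR π.length le_rfl) _ (List.mem_map_of_mem (by simpa using hS))
  have hprefix : ∀ i ≤ π.length, ∀ S ∈ π.take i, Detectable F (e := e) (10 * U) fun B =>
      (Good h ρ R B ∧ ¬ Holds h ρ B (prefixFormula π i)) ∧ ¬ Holds h ρ B S.toFormula := by
    intro i hi S hS
    refine ((hb.detectable_or_intro ρ hR (hπR i hi) (φ := .neg S.toFormula)
      (List.mem_map_of_mem hS)).cases (hb.detectable_neg ρ (φ := S.toFormula)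
      (hR.depth_le (hR.neg (hmemR S (List.mem_of_mem_take hS))))) fun B hB => ?_).le (by omega)
    rw [prefixFormula] at hB
    tauto
  -- At a change of truth value the larger prefix yields a false sequent. The sequents with index
  -- below `i` are true because the smaller prefix formula is false, so the false one is `π[i]`.
  have hstep : ∀ i, 0 ≤ i → i < π.length → Detectable F (e := e) ((k + 330) * U) fun B =>
      Good h ρ R B ∧ B (toLow e (hat h ρ (prefixFormula π i))) ∈ ({0} : Set (ZMod p)) ∧
        B (toLow e (hat h ρ (prefixFormula π (i + 1)))) ∉ ({0} : Set (ZMod p)) := by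
    intro i _ hi
    have hPQ := hb.detectable_or_cases hR (k := (k + 305) * U) (ρ := ρ) (F := F)
      (P := fun B => Good h ρ R B ∧ ¬ Holds h ρ B (prefixFormula π i)) (hπR (i + 1) hi)
      (fun B hB => hB.1) fun χ hχ => ?_
    · refine hPQ.mono (fun B hB => ⟨⟨hB.1, fun hh => hh hB.2.1⟩, hB.2.2⟩) ?_
      have h1 : (k + 330) * U = (k + 305) * U + 25 * U := by ring
      omega
    · obtain ⟨S, hS, rfl⟩ := List.mem_map.1 hχ
      have hSπ := hR.neg (hmemR S (List.mem_of_mem_take hS))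
      have hneg : Detectable F (e := e) ((k + 300) * U) fun B =>
          (Good h ρ R B ∧ ¬ Holds h ρ B (prefixFormula π i)) ∧ ¬ Holds h ρ B S.toFormula := by
        rw [List.take_succ_eq_append_getElem hi, List.mem_append, List.mem_singleton] at hS
        rcases hS with hS | rfl
        · refine (hprefix i hi.le S hS).le ?_
          have h1 : (k + 300) * U = k * U + 300 * U := by ring
          omega
        · refine hb.detectable_infer hR (T := fun S => S ∈ π.take i) hSπ
            (fun B hB => ⟨hB.1.1, hB.2⟩) hA
            (fun S' hS' => hR.neg (hmemR S' (List.mem_of_mem_take hS')))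
            (fun S' hS' => (hprefix i hi.le S' hS').imp fun B hB => ⟨hB.1.1, hB.2⟩)
            (hπ.infer i hi)
      refine (hneg.cases (hb.detectable_neg ρ (φ := S.toFormula) (hR.depth_le hSπ))
        fun B hB => ?_).le ?_
      · tauto
      · have h1 : (k + 305) * U = (k + 300) * U + 5 * U := by ring
        omega
  have hsearch := Detectable.binary_search (P := Good h ρ R)
    (fun i => toLow e (hat h ρ (prefixFormula π i))) {0} L 0 π.length (Nat.zero_le _)
    (by simpa using hlen) hstep
  -- The end points: the prefix formula of length zero and the empty sequent are both empty
  -- disjunctions, hence false. As the empty sequent occurs in `π`, the full prefix formula is true.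
  have hzero := hb.detectable_or_cases hR (k := 0) (ρ := ρ) (F := F) (P := Good h ρ R)
    (hπR 0 (Nat.zero_le _)) (fun B hB => hB) (by simp)
  have hmem : (⟨[], []⟩ : Sequent p V) ∈ π.take π.length := by
    rw [List.take_length]
    exact List.mem_of_getLast? hπ.last
  have hlast := hprefix π.length le_rfl _ hmem
  have hempty := hb.detectable_or_cases hR (k := 0) (ρ := ρ) (F := F) (P := Good h ρ R)
    (φs := []) (hR.neg (hmemR ⟨[], []⟩ (by simpa using hmem))) (fun B hB => hB) (by simp)
  refine (((hsearch.or hzero).or hlast).cases hempty fun B hB => ?_).le ?_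
  · have e1 : ∀ i, B (toLow e (hat h ρ (prefixFormula π i))) ∈ ({0} : Set (ZMod p)) ↔
        ¬ Holds h ρ B (prefixFormula π i) := fun i => (not_not (a := _ = (0 : ZMod p))).symm
    simp only [e1]
    have e2 : (⟨[], []⟩ : Sequent p V).toFormula = .or [] := rfl
    have e3 : prefixFormula π 0 = .or ((π.take 0).map fun S => .neg S.toFormula) := rfl
    rw [← e3, e2]
    tauto
  · have h1 : (k + 400) * U = (k + 330) * U + 70 * U := by ring
    omega

end Refutations

-- Choice of the random coefficients

section Counting
open MvPolynomial Formula

variable {p : ℕ} {V : Type u}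

open scoped Classical in
/-- Coefficients given on a finite index set, extended by zero. -/
noncomputable def extendCoeffs {I : Finset (Formula p V × ℕ × ℕ)} (w : I → ZMod p) :
    Formula p V → ℕ → ℕ → ZMod p :=
  fun φ i j => if ht : (φ, i, j) ∈ I then w ⟨(φ, i, j), ht⟩ else 0

open scoped Classical in
/-- Change of the coefficients of the `j`-th disjunct of `ψ`. -/
noncomputable def shiftCoeffs {I : Finset (Formula p V × ℕ × ℕ)} (ψ : Formula p V) (j : ℕ)
    {h : ℕ} (w : I → ZMod p) (c : Fin h → ZMod p) : I → ZMod p :=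
  fun t => w t + if ht : t.1.1 = ψ ∧ t.1.2.2 = j ∧ t.1.2.1 < h then c ⟨t.1.2.1, ht.2.2⟩ else 0

theorem extendCoeffs_shift_of_ne {I : Finset (Formula p V × ℕ × ℕ)} {ψ φ : Formula p V} {j h : ℕ}
    (w : I → ZMod p) (c : Fin h → ZMod p) (hne : φ ≠ ψ) :
    extendCoeffs (shiftCoeffs ψ j w c) φ = extendCoeffs w φ := by
  funext i k
  simp [extendCoeffs, shiftCoeffs, hne]

theorem extendCoeffs_shift {I : Finset (Formula p V × ℕ × ℕ)} {ψ : Formula p V} {j h : ℕ}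
    (w : I → ZMod p) (c : Fin h → ZMod p) (i : Fin h) (hI : (ψ, i.1, j) ∈ I) :
    extendCoeffs (shiftCoeffs ψ j w c) ψ i = extendCoeffs w ψ i + Pi.single j (c i) := by
  classical
  funext k
  rw [Pi.add_apply]
  by_cases hk : k = j
  · subst hk
    simp [extendCoeffs, shiftCoeffs, hI]
  · simp [extendCoeffs, shiftCoeffs, hk]

/-- The coefficients `ρ` hide the true `j`-th disjunct of the disjunction `ψ` from `B`. -/
def Hides {e : ℕ} (h : ℕ) (ρ : Formula p V → ℕ → ℕ → ZMod p) (ψ : Formula p V) (j : ℕ)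
    (B : LowDeg p V e → ZMod p) : Prop :=
  ∃ φs, ψ = .or φs ∧ ∃ hj : j < (flatAll φs).length, Holds h ρ B (flatAll φs)[j] ∧
    (∀ i < h, val B (linComb (ρ (.or φs) i) ((flatAll φs).map (hat h ρ))) = 0) ∧
    ∀ i < h, ∀ c : ZMod p,
      val B (linComb (ρ (.or φs) i) ((flatAll φs).map (hat h ρ)) + C c * hat h ρ (flatAll φs)[j]) =
        val B (linComb (ρ (.or φs) i) ((flatAll φs).map (hat h ρ))) +
          c * val B (hat h ρ (flatAll φs)[j])

theorem exists_hides_of_not_good {e h : ℕ} {ρ : Formula p V → ℕ → ℕ → ZMod p}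
    {R : Set (Formula p V)} {B : LowDeg p V e → ZMod p} (hB : ¬ Good h ρ R B) :
    ∃ φs, Formula.or φs ∈ R ∧ ∃ j < (flatAll φs).length, Hides h ρ (.or φs) j B := by
  simp only [Good, not_forall, not_or, not_exists, not_and, not_not] at hB
  obtain ⟨φs, hR, a, ha, hBa, h1, h2⟩ := hB
  obtain ⟨j, hj, rfl⟩ := List.getElem_of_mem ha
  exact ⟨φs, hR, j, hj, φs, rfl, hj, hBa, h1, h2⟩

variable [Fact p.Prime]

/-- The disjuncts keep their polynomials under a shift at `ψ`. Hiding says that the shifted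
combination takes the value `c i` times the nonzero value of the hidden disjunct, so the shifted
coefficients determine `c`, and then `w`. Linearity of `B` is used only at the sums where hiding
grants it. -/
theorem hides_injective {e h j : ℕ} {I : Finset (Formula p V × ℕ × ℕ)} {ψ : Formula p V}
    {B : LowDeg p V e → ZMod p} (hI : ∀ i < h, (ψ, i, j) ∈ I) {w w' : I → ZMod p}
    {c c' : Fin h → ZMod p} (hw : Hides h (extendCoeffs w) ψ j B)
    (hw' : Hides h (extendCoeffs w') ψ j B) (hs : shiftCoeffs ψ j w c = shiftCoeffs ψ j w' c') :
    w = w' ∧ c = c' := by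
  obtain ⟨φs, rfl, hj, hv, h0, hadd⟩ := hw
  obtain ⟨φs', hφ, hj', hv', h0', hadd'⟩ := hw'
  injection hφ with hφ
  subst hφ
  have hhat : ∀ a ∈ flatAll φs, hat h (extendCoeffs w) a = hat h (extendCoeffs w') a := by
    intro a ha
    refine hat_congr a fun χ hχ => ?_
    have hne : χ ≠ .or φs := by
      rintro rfl
      exact absurd (size_lt_of_mem_flatAll ha) (by omega)
    rw [← extendCoeffs_shift_of_ne (j := j) w c hne, hs, extendCoeffs_shift_of_ne w' c' hne]
  have hl : (flatAll φs).map (hat h (extendCoeffs w)) =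
      (flatAll φs).map (hat h (extendCoeffs w')) := List.map_congr_left hhat
  have hc : c = c' := by
    funext i
    have key : linComb (extendCoeffs (shiftCoeffs (.or φs) j w c) (.or φs) i)
          ((flatAll φs).map (hat h (extendCoeffs w))) =
        linComb (extendCoeffs (shiftCoeffs (.or φs) j w' c') (.or φs) i)
          ((flatAll φs).map (hat h (extendCoeffs w'))) := by rw [hs, hl]
    have hlen : ∀ w : I → ZMod p,
        j < ((flatAll φs).map (hat h (extendCoeffs w))).length := fun w => by simpa using hj
    have hget : ∀ w : I → ZMod p, ((flatAll φs).map (hat h (extendCoeffs w))).getD j 0 =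
        hat h (extendCoeffs w) (flatAll φs)[j] := fun w => by
      rw [List.getD_eq_getElem _ _ (hlen w), List.getElem_map]
    rw [extendCoeffs_shift w c i (hI i i.2), extendCoeffs_shift w' c' i (hI i i.2), linComb_add,
      linComb_add, linComb_single _ (hlen w), linComb_single _ (hlen w'), hget, hget] at key
    have := congrArg (val B) key
    rw [hadd i i.2, hadd' i i.2, h0 i i.2, h0' i i.2, zero_add, zero_add,
      ← hhat _ (List.getElem_mem hj)] at this
    exact mul_right_cancel₀ hv this
  refine ⟨?_, hc⟩
  subst hc
  funext t
  have := congrFun hs t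
  exact add_right_cancel this

open scoped Classical in
-- Every hiding choice has `p ^ h` shifts, and all of these are distinct by `hides_injective`; so
-- the proportion of hiding choices is at most `p ^ (-h)`, whatever the map `B`.
theorem card_hides_mul_le {e h j : ℕ} {I : Finset (Formula p V × ℕ × ℕ)} {ψ : Formula p V}
    (B : LowDeg p V e → ZMod p) (hI : ∀ i < h, (ψ, i, j) ∈ I) :
    (Finset.univ.filter fun w : I → ZMod p => Hides h (extendCoeffs w) ψ j B).card * p ^ h ≤
      Fintype.card (I → ZMod p) := by
  have hc : p ^ h = (Finset.univ : Finset (Fin h → ZMod p)).card := by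
    simp [ZMod.card]
  rw [hc, ← Finset.card_product, ← Finset.card_univ]
  refine Finset.card_le_card_of_injOn (fun t => shiftCoeffs ψ j t.1 t.2)
    (fun _ _ => Finset.mem_coe.2 (Finset.mem_univ _)) ?_
  rintro ⟨w, c⟩ hw ⟨w', c'⟩ hw' hs
  simp only [Finset.coe_product, Set.mem_prod, Finset.mem_coe, Finset.mem_filter,
    Finset.mem_univ, true_and, and_true] at hw hw'
  obtain ⟨rfl, rfl⟩ := hides_injective hI hw hw' hs
  rfl

open scoped Classical in
/-- Some choice of coefficients is good for half of the maps. -/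
theorem exists_coeffs {e h N : ℕ} (R : Finset (Formula p V))
    (hN : ∀ φs, Formula.or φs ∈ R → (flatAll φs).length ≤ N) (hcard : 2 * (R.card * N) ≤ p ^ h)
    (Ω : Finset (LowDeg p V e → ZMod p)) :
    ∃ ρ : Formula p V → ℕ → ℕ → ZMod p,
      2 * (Ω.filter fun B => ¬ Good h ρ (R : Set (Formula p V)) B).card ≤ Ω.card := by
  set I : Finset (Formula p V × ℕ × ℕ) := R ×ˢ (Finset.range h ×ˢ Finset.range N) with hI
  have hpos : 0 < p ^ h := pow_pos (Fact.out : p.Prime).pos h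
  have hB : ∀ B : LowDeg p V e → ZMod p, 2 * (Finset.univ.filter fun w : I → ZMod p =>
      ¬ Good h (extendCoeffs w) (R : Set (Formula p V)) B).card ≤ Fintype.card (I → ZMod p) := by
    intro B
    have h1 : (Finset.univ.filter fun w : I → ZMod p =>
        ¬ Good h (extendCoeffs w) (R : Set (Formula p V)) B) ⊆
        (R ×ˢ Finset.range N).biUnion fun t =>
          Finset.univ.filter fun w : I → ZMod p => Hides h (extendCoeffs w) t.1 t.2 B := by
      intro w hw
      obtain ⟨φs, hR, j, hj, hh⟩ := exists_hides_of_not_good (Finset.mem_filter.1 hw).2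
      rw [Finset.mem_biUnion]
      refine ⟨(.or φs, j), ?_, by simpa using hh⟩
      rw [Finset.mem_product, Finset.mem_range]
      exact ⟨hR, hj.trans_le (hN φs hR)⟩
    have h2 := (Finset.card_le_card h1).trans Finset.card_biUnion_le
    have h3 : (∑ t ∈ R ×ˢ Finset.range N, (Finset.univ.filter fun w : I → ZMod p =>
        Hides h (extendCoeffs w) t.1 t.2 B).card) * p ^ h ≤
        (R.card * N) * Fintype.card (I → ZMod p) := by
      rw [Finset.sum_mul]
      refine (Finset.sum_le_card_nsmul _ _ (Fintype.card (I → ZMod p)) fun t ht => ?_).trans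
        (le_of_eq ?_)
      · rw [Finset.mem_product] at ht
        refine card_hides_mul_le B fun i hi => ?_
        simp only [hI, Finset.mem_product, Finset.mem_range]
        exact ⟨ht.1, hi, Finset.mem_range.1 ht.2⟩
      · rw [Finset.card_product, Finset.card_range, smul_eq_mul]
    have h4 := (Nat.mul_le_mul_right (p ^ h) h2).trans h3
    refine Nat.le_of_mul_le_mul_right (c := p ^ h) ?_ hpos
    have h5 := Nat.mul_le_mul_right (Fintype.card (I → ZMod p)) hcard
    nlinarith
  -- Double counting of pairs: if every choice were bad for more than half of `Ω`, some map would
  -- find more than half of the choices bad.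
  by_contra! hcon
  have h1 : ∑ B ∈ Ω, (2 * (Finset.univ.filter fun w : I → ZMod p =>
      ¬ Good h (extendCoeffs w) (R : Set (Formula p V)) B).card) ≤
      Ω.card * Fintype.card (I → ZMod p) := by
    simpa using Finset.sum_le_card_nsmul Ω _ _ fun B _ => hB B
  have h2 : Fintype.card (I → ZMod p) * Ω.card < ∑ w : I → ZMod p,
      (2 * (Ω.filter fun B => ¬ Good h (extendCoeffs w) (R : Set (Formula p V)) B).card) := by
    have : ∑ w : I → ZMod p, Ω.card < ∑ w : I → ZMod p,
        (2 * (Ω.filter fun B => ¬ Good h (extendCoeffs w) (R : Set (Formula p V)) B).card) :=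
      Finset.sum_lt_sum_of_nonempty Finset.univ_nonempty fun w _ => hcon (extendCoeffs w)
    simpa using this
  have h3 := Finset.sum_card_bipartiteAbove_eq_sum_card_bipartiteBelow
    (s := Ω) (t := (Finset.univ : Finset (I → ZMod p)))
    fun B w => ¬ Good h (extendCoeffs w) (R : Set (Formula p V)) B
  simp only [Finset.bipartiteAbove, Finset.bipartiteBelow] at h3
  rw [← Finset.mul_sum] at h1 h2
  rw [h3] at h1
  rw [mul_comm] at h2
  omega

open scoped Classical in
theorem probNoError_le_half {F : Finset (MvPolynomial V (ZMod p))} {e : ℕ}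
    {Ω : Finset (LowDeg p V e → ZMod p)} {P : (LowDeg p V e → ZMod p) → Prop}
    {T : SearchTree p (LowDeg p V e) (ErrorLabel p F e)} (hT : ∀ B, P B → (T.eval B).IsError B)
    (hP : 2 * (Ω.filter fun B => ¬ P B).card ≤ Ω.card) : probNoError Ω T ≤ 1 / 2 := by
  rw [probNoError]
  have h1 : (Ω.filter fun B => ¬ (T.eval B).IsError B).card ≤ (Ω.filter fun B => ¬ P B).card :=
    Finset.card_le_card (Finset.monotone_filter_right _ fun B _ hB hPB => hB (hT B hPB))
  have h2 : (Ω.filter fun B => ¬ (T.eval B).IsError B).card * 2 ≤ 1 * Ω.card := by omega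
  rcases Ω.card.eq_zero_or_pos with h0 | h0
  · rw [h0]; norm_num
  · rw [div_le_div_iff₀ (by exact_mod_cast h0) two_pos]
    exact_mod_cast h2

end Counting

-- The formulas relevant to a refutation

section Sizes
open Formula

variable {p : ℕ} {V : Type u}

theorem Formula.depthUnderOr_le {k : ℕ} {φs : List (Formula p V)}
    (h : ∀ φ ∈ φs, φ.depth + 1 ≤ k) : depthUnderOr φs ≤ k := by
  induction φs with
  | nil => simp [depthUnderOr]
  | cons φ φs ih =>
    rw [depthUnderOr]
    have h1 := h φ (by simp)
    exact max_le (by split_ifs <;> omega) (ih fun ψ hψ => h ψ (by simp [hψ]))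

theorem Formula.depth_or_le {k : ℕ} {φs : List (Formula p V)} (hk : 1 ≤ k)
    (h : ∀ φ ∈ φs, φ.depth + 1 ≤ k) : (or φs).depth ≤ k := by
  rw [depth]
  exact max_le hk (depthUnderOr_le h)

theorem Formula.depth_neg_le (φ : Formula p V) : (neg φ).depth ≤ φ.depth + 1 := by
  simp only [depth]; split <;> omega

theorem Formula.depth_le_or {φ : Formula p V} {φs : List (Formula p V)} (h : φ ∈ φs) :
    φ.depth ≤ (or φs).depth := by
  have := le_depthUnderOr h
  rw [depth]
  refine le_trans ?_ (le_max_right _ _)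
  split_ifs at this <;> omega

theorem Formula.depth_size_le_of_mem_subs (φ : Formula p V) :
    ∀ ψ ∈ subs φ, ψ.depth ≤ φ.depth ∧ ψ.size ≤ φ.size := by
  induction φ using size_induction
  rename_i φ ih
  intro ψ hψ
  cases φ with
  | var x => simp only [subs, List.mem_singleton] at hψ; subst hψ; exact ⟨le_rfl, le_rfl⟩
  | neg φ =>
    rcases List.mem_cons.1 hψ with rfl | hψ
    · exact ⟨le_rfl, le_rfl⟩
    · have := ih φ (by simp [size]) ψ hψ
      exact ⟨this.1.trans (depth_le_neg φ), this.2.trans (by simp [size])⟩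
  | or φs =>
    rcases List.mem_cons.1 hψ with rfl | hψ
    · exact ⟨le_rfl, le_rfl⟩
    · obtain ⟨φ, hφ, hψ⟩ := mem_subsAll.1 hψ
      have := ih φ (size_lt_or hφ) ψ hψ
      exact ⟨this.1.trans (depth_le_or hφ), this.2.trans (size_lt_or hφ).le⟩
  | mod i φs =>
    rcases List.mem_cons.1 hψ with rfl | hψ
    · exact ⟨le_rfl, le_rfl⟩
    · obtain ⟨φ, hφ, hψ⟩ := mem_subsAll.1 hψ
      have := ih φ (size_lt_mod i hφ) ψ hψ
      refine ⟨this.1.trans ?_, this.2.trans (size_lt_mod i hφ).le⟩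
      rw [depth]
      exact (depth_le_depthMax hφ).trans (Nat.le_succ _)

theorem Formula.sizeSum_append (φs ψs : List (Formula p V)) :
    sizeSum (φs ++ ψs) = sizeSum φs + sizeSum ψs := by
  induction φs with
  | nil => simp [sizeSum]
  | cons φ φs ih => simp [sizeSum, ih, add_assoc]

theorem Formula.sizeSum_map_neg_le (φs : List (Formula p V)) :
    sizeSum (φs.map neg) ≤ 2 * sizeSum φs := by
  induction φs with
  | nil => simp [sizeSum]
  | cons φ φs ih =>
    have := size_pos φ
    simp only [List.map_cons, sizeSum, size]
    omega

theorem size_neg_toFormula_le (S : Sequent p V) : (Formula.neg S.toFormula).size ≤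
    2 * (1 + sizeSum S.ante + sizeSum S.succ) := by
  have := sizeSum_map_neg_le S.ante
  rw [Sequent.toFormula, size, size, sizeSum_append]
  omega

theorem size_prefixFormula_le (π : List (Sequent p V)) (i : ℕ) :
    (prefixFormula π i).size ≤ 2 * proofSize π + 1 := by
  rw [prefixFormula, size]
  refine Nat.succ_le_succ ?_
  induction π generalizing i with
  | nil => simp [sizeSum]
  | cons S π ih =>
    cases i with
    | zero => simp [sizeSum]
    | succ i =>
      have h1 := ih i
      have h2 := size_neg_toFormula_le S
      simp only [List.take_succ_cons, List.map_cons, sizeSum, proofSize, List.sum_cons] at h1 h2 ⊢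
      omega

theorem length_le_proofSize (π : List (Sequent p V)) : π.length ≤ proofSize π := by
  induction π with
  | nil => simp
  | cons S π ih =>
    simp only [proofSize, List.map_cons, List.sum_cons, List.length_cons] at ih ⊢
    omega

/-- The four extra levels are the negated antecedents, the disjunction for the sequent, its
negation, and the outer disjunction. -/
theorem depth_prefixFormula_le {d : ℕ} {π : List (Sequent p V)}
    (hd : ∀ S ∈ π, ∀ φ ∈ S.ante ++ S.succ, φ.depth ≤ d) (i : ℕ) :
    (prefixFormula π i).depth ≤ d + 4 := by
  refine depth_or_le (by omega) fun χ hχ => ?_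
  obtain ⟨S, hS, rfl⟩ := List.mem_map.1 hχ
  have hS := hd S (List.mem_of_mem_take hS)
  have h1 : S.toFormula.depth ≤ d + 2 := by
    refine depth_or_le (by omega) fun ψ hψ => ?_
    rcases List.mem_append.1 hψ with hψ | hψ
    · obtain ⟨φ, hφ, rfl⟩ := List.mem_map.1 hψ
      have := hS φ (by simp [hφ])
      have := depth_neg_le φ
      omega
    · have := hS ψ (by simp [hψ])
      omega
  have := depth_neg_le S.toFormula
  omega

open scoped Classical in
/-- All subformulas of the formulas expressing that one of the first sequents is false. -/
noncomputable def relevantFormulas (π : List (Sequent p V)) : Finset (Formula p V) :=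
  ((List.range (π.length + 1)).flatMap fun i => subs (prefixFormula π i)).toFinset

theorem mem_relevantFormulas {π : List (Sequent p V)} {φ : Formula p V} :
    φ ∈ relevantFormulas π ↔ ∃ i ≤ π.length, φ ∈ subs (prefixFormula π i) := by
  simp [relevantFormulas]

theorem card_relevantFormulas_le (π : List (Sequent p V)) :
    (relevantFormulas π).card ≤ (π.length + 1) * (2 * proofSize π + 1) := by
  classical
  refine (List.toFinset_card_le _).trans ?_
  rw [List.length_flatMap]
  refine (List.sum_le_card_nsmul _ (2 * proofSize π + 1) ?_).trans (by simp)
  intro n hn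
  obtain ⟨i, -, rfl⟩ := List.mem_map.1 hn
  rw [length_subs]
  exact size_prefixFormula_le π i

theorem length_flatAll_le_of_mem {π : List (Sequent p V)} {φs : List (Formula p V)}
    (h : Formula.or φs ∈ relevantFormulas π) : (flatAll φs).length ≤ 2 * proofSize π := by
  obtain ⟨i, -, h⟩ := mem_relevantFormulas.1 h
  have h1 := (depth_size_le_of_mem_subs _ _ h).2
  have h2 := size_prefixFormula_le π i
  have h3 := length_flatAll_le φs
  rw [size] at h1
  omega

theorem admissible_relevantFormulas {d L : ℕ} {π : List (Sequent p V)}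
    (hd : ∀ S ∈ π, ∀ φ ∈ S.ante ++ S.succ, φ.depth ≤ d) (hL : 2 * proofSize π ≤ 2 ^ L) :
    Admissible (relevantFormulas π : Set (Formula p V)) L (d + 4) where
  neg {φ} h := by
    obtain ⟨i, hi, h⟩ := mem_relevantFormulas.1 h
    exact mem_relevantFormulas.2 ⟨i, hi, (subClosed_subs _).neg h⟩
  or {φs} h φ hφ := by
    obtain ⟨i, hi, h⟩ := mem_relevantFormulas.1 h
    exact mem_relevantFormulas.2 ⟨i, hi, (subClosed_subs _).or h φ hφ⟩
  mod {c φs} h φ hφ := by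
    obtain ⟨i, hi, h⟩ := mem_relevantFormulas.1 h
    exact mem_relevantFormulas.2 ⟨i, hi, (subClosed_subs _).mod h φ hφ⟩
  depth_le {φ} h := by
    obtain ⟨i, hi, h⟩ := mem_relevantFormulas.1 h
    exact (depth_size_le_of_mem_subs _ _ h).1.trans (depth_prefixFormula_le hd i)
  length_le h := (length_flatAll_le_of_mem h).trans hL

end Sizes

-- Choice of the numerical parameters

section Parameters

variable {p : ℕ} {V : Type u} [Fintype V]

/-- With `h = H ^ 2` and `p ≤ H` a unit of depth contributes a factor at most `H ^ 3` to the degree,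
whence `M = H ^ (3 * d + 3)`. The dominant cost is `h * p * mulCost p H M`; `U = H ^ 7 * M` covers
it with room for the constants, which are absorbed into spare factors `H ≥ 100` by `up`. -/
theorem budget_of_le {H d e : ℕ} (hH : 100 ≤ H) (hpH : p ≤ H)
    (hV : Fintype.card V + 1 ≤ 2 ^ H) (he : H ^ (3 * d + 12) ≤ e) :
    Budget p V (H ^ 2) H (H ^ (3 * d + 3)) (H + 2) d e (H ^ (3 * d + 10)) := by
  have e1 : H ^ (3 * d + 12) = H ^ 9 * H ^ (3 * d + 3) := by rw [← pow_add]; congr 1; omega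
  have e2 : H ^ (3 * d + 10) = H ^ 7 * H ^ (3 * d + 3) := by rw [← pow_add]; congr 1; omega
  have hM : (H ^ 2 * p) ^ (d + 1) ≤ H ^ (3 * d + 3) := by
    calc (H ^ 2 * p) ^ (d + 1) ≤ (H ^ 2 * H) ^ (d + 1) :=
          Nat.pow_le_pow_left (Nat.mul_le_mul_left _ hpH) _
      _ = H ^ (3 * d + 3) := by rw [← pow_succ, ← pow_mul]; congr 1
  have hX : 1 ≤ H ^ (3 * d + 3) := Nat.one_le_pow _ _ (by omega)
  rw [e1] at he
  rw [e2]
  generalize H ^ (3 * d + 3) = X at *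
  have up : ∀ a b : ℕ, a ≤ 100 * b → a ≤ H * b := fun a b h => h.trans (Nat.mul_le_mul_right b hH)
  have h1 : H ≤ H * X := Nat.le_mul_of_pos_right _ hX
  have hA : mulCost p H X + 3 ≤ H * (H * X) := up _ _ (by unfold mulCost; omega)
  have hpA : p * (mulCost p H X + 3) ≤ H * (H * (H * X)) := Nat.mul_le_mul hpH hA
  have h3 : H * X ≤ H * (H * X) := Nat.le_mul_of_pos_left _ (by omega)
  have h4 : H * (H * X) ≤ H * (H * (H * X)) := Nat.le_mul_of_pos_left _ (by omega)
  have h5 : H * (H * (H * X)) ≤ H * (H * (H * (H * X))) := Nat.le_mul_of_pos_left _ (by omega)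
  have h6 : H * (H * (H * (H * X))) ≤ H * (H * (H * (H * (H * X)))) :=
    Nat.le_mul_of_pos_left _ (by omega)
  have h7 : H * (H * (H * (H * (H * X)))) ≤ H * (H * (H * (H * (H * (H * X))))) :=
    Nat.le_mul_of_pos_left _ (by omega)
  have h8 : H * (H * (H * (H * (H * (H * X))))) ≤ H * (H * (H * (H * (H * (H * (H * X)))))) :=
    Nat.le_mul_of_pos_left _ (by omega)
  have eU : H ^ 7 * X = H * (H * (H * (H * (H * (H * (H * X)))))) := by ring
  have eh : ∀ a, H ^ 2 * a = H * (H * a) := fun a => by ring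
  have hle : ∀ a b : ℕ, a ≤ b → H ^ 2 * a ≤ H * (H * b) := fun a b h => by
    rw [eh]; exact Nat.mul_le_mul_left _ (Nat.mul_le_mul_left _ h)
  rw [eU]
  refine ⟨hV, Nat.one_le_pow _ _ (by omega), hM, ?_, up _ _ ?_, up _ _ ?_, up _ _ ?_, up _ _ ?_⟩
  · refine le_trans (Nat.mul_le_mul_right X ?_) he
    exact (show 2 ≤ H by omega).trans (Nat.le_self_pow (by omega) H)
  · have h9 := hle _ _ hA
    have h10 := hle (p * (mulCost p H X + 3) + 3 * p + 15) (H * (H * (H * (H * X))))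
      (up _ _ (by omega))
    omega
  · omega
  · have : H ^ 2 ≤ H * (H * X) := by
      have := eh X
      rw [← this]; exact Nat.le_mul_of_pos_right _ hX
    omega
  · have h9 : p * (3 * p + 6) ≤ H * (H * (H * X)) := Nat.mul_le_mul hpH (up _ _ (by omega))
    have h10 := hle (p * (3 * p + 6) + 3) (H * (H * (H * (H * X)))) (up _ _ (by omega))
    omega

/-- A short refutation yields a shallow search tree that finds an error for half of the maps. -/
theorem exists_searchTree [Fact p.Prime] {F : Finset (MvPolynomial V (ZMod p))} {H d D e : ℕ}
    (hH : 100 ≤ H) (hpH : p ≤ H) (hDH : D ≤ H) (hV : Fintype.card V + 1 ≤ 2 ^ H)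
    (he : H ^ (3 * d + 24) ≤ e) (hF : ∀ f ∈ F, f.totalDegree ≤ D)
    (Ω : Finset (LowDeg p V e → ZMod p)) {π : List (Sequent p V)}
    (hπ : IsRefutation d (eqFormula '' (F : Set (MvPolynomial V (ZMod p)))) π)
    (hsize : proofSize π ≤ 2 ^ H) :
    ∃ T : SearchTree p (LowDeg p V e) (ErrorLabel p F e), T.DepthLE e ∧
      probNoError Ω T ≤ 1 / 2 := by
  have hp2 := (Fact.out : p.Prime).two_le
  have hs1 : 1 ≤ proofSize π := by
    refine le_trans ?_ (length_le_proofSize π)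
    exact List.length_pos_of_mem (List.mem_of_getLast? hπ.last)
  have hlen := length_le_proofSize π
  have hp1 : 2 ^ (H + 1) = 2 * 2 ^ H := by rw [pow_succ, mul_comm]
  have hp3 : 2 ^ (H + 2) = 4 * 2 ^ H := by rw [pow_add, mul_comm]; norm_num
  have hb := budget_of_le (V := V) (d := d + 4) hH hpH hV
    (e := e) (by rwa [show 3 * (d + 4) + 12 = 3 * d + 24 by ring])
  have hR := admissible_relevantFormulas (L := H + 2) hπ.depth_le (by omega)
  -- The union bound runs over fewer than `2 ^ (3 * H + 4)` pairs of a disjunction and a disjunct,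
  -- far below `2 ^ h` for `h = H ^ 2`.
  have hcount : 2 * ((relevantFormulas π).card * (2 * proofSize π)) ≤ p ^ (H ^ 2) := by
    calc 2 * ((relevantFormulas π).card * (2 * proofSize π))
        ≤ 2 * (((π.length + 1) * (2 * proofSize π + 1)) * (2 * proofSize π)) :=
          Nat.mul_le_mul_left _ (Nat.mul_le_mul_right _ (card_relevantFormulas_le π))
      _ ≤ 2 * ((2 ^ (H + 1) * 2 ^ (H + 2)) * 2 ^ (H + 1)) := by
          gcongr <;> omega
      _ = 2 ^ (3 * H + 5) := by rw [← pow_add, ← pow_add, ← pow_succ']; congr 1; ring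
      _ ≤ 2 ^ (H ^ 2) := Nat.pow_le_pow_right two_pos (by nlinarith)
      _ ≤ p ^ (H ^ 2) := Nat.pow_le_pow_left hp2 _
  obtain ⟨ρ, hρ⟩ := exists_coeffs (h := H ^ 2) (N := 2 * proofSize π) (relevantFormulas π)
    (fun φs hφ => length_flatAll_le_of_mem hφ) hcount Ω
  have hDM : D ≤ H ^ (3 * (d + 4) + 3) := hDH.trans (Nat.le_self_pow (by omega) H)
  obtain ⟨T, hT, hE⟩ := hb.detectable_good (F := F) (ρ := ρ) (k := 17 * D + 30) hR hπ
    (fun i hi => mem_relevantFormulas.2 ⟨i, hi, Formula.mem_subs_self _⟩) (by omega) (by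
      rintro _ ⟨f, hf, rfl⟩ hm
      exact hb.detectable_eqFormula hR hf (hF f hf) hDM hm)
  refine ⟨T, hT.mono (le_trans ?_ he), probNoError_le_half hE hρ⟩
  calc (17 * D + 30 + 400) * H ^ (3 * (d + 4) + 10) ≤ (H * H) * H ^ (3 * (d + 4) + 10) :=
        Nat.mul_le_mul_right _ (by nlinarith)
    _ = H ^ (3 * d + 24) := by rw [← pow_two, ← pow_add]; congr 1; ring

end Parameters

-- Asymptotics and conclusion

theorem add_one_le_two_pow_floor {C n : ℕ} {y : ℝ} (hn : 1 ≤ n) (hlog : Real.log n ≤ y)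
    (hy : 2 * (C : ℝ) + 3 ≤ y) : C * n ^ C + 1 ≤ 2 ^ ⌊y ^ 2⌋₊ := by
  have hn' : (0 : ℝ) < n := by exact_mod_cast hn
  have hC : (0 : ℝ) ≤ C := Nat.cast_nonneg C
  have hH : y ^ 2 - 1 ≤ (⌊y ^ 2⌋₊ : ℝ) := (Nat.sub_one_lt_floor _).le
  have h1 : ((C * n ^ C + 1 : ℕ) : ℝ) ≤ (C + 1) * (n : ℝ) ^ C := by
    push_cast
    have : (1 : ℝ) ≤ (n : ℝ) ^ C := one_le_pow₀ (by exact_mod_cast hn)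
    linarith
  have h2 : (n : ℝ) ^ C = Real.exp (C * Real.log n) := by
    rw [Real.exp_nat_mul, Real.exp_log hn']
  have h3 : ((C * n ^ C + 1 : ℕ) : ℝ) ≤ Real.exp (C + C * Real.log n) := by
    rw [Real.exp_add, ← h2]
    exact h1.trans (mul_le_mul_of_nonneg_right (Real.add_one_le_exp _) (by positivity))
  have h4 : ((2 ^ ⌊y ^ 2⌋₊ : ℕ) : ℝ) = Real.exp (⌊y ^ 2⌋₊ * Real.log 2) := by
    rw [Real.exp_nat_mul, Real.exp_log two_pos]; push_cast; rfl
  -- Since `Real.log 2 ≥ 1 / 2`, it is enough that `C * (1 + y) ≤ (y ^ 2 - 1) / 2`, which is `2 * C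
  -- ≤ y - 1`. Squaring `y` is what beats the unknown exponent `C`.
  have h5 : (C : ℝ) + C * Real.log n ≤ ⌊y ^ 2⌋₊ * Real.log 2 := by
    have hl : (1 / 2 : ℝ) ≤ Real.log 2 := by have := Real.log_two_gt_d9; linarith
    have h6 : (C : ℝ) * Real.log n ≤ C * y := mul_le_mul_of_nonneg_left hlog hC
    have h7 : (⌊y ^ 2⌋₊ : ℝ) * (1 / 2) ≤ ⌊y ^ 2⌋₊ * Real.log 2 :=
      mul_le_mul_of_nonneg_left hl (Nat.cast_nonneg _)
    nlinarith
  have := h3.trans ((Real.exp_le_exp.2 h5).trans h4.symm.le)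
  exact_mod_cast this

/-- The logarithm is eventually bounded by every positive power of `r`. -/
theorem eventually_log_le_rpow {r : ℕ → ℕ}
    (hr : ∃ g : ℕ → ℝ, Tendsto g atTop atTop ∧
      ∀ᶠ n : ℕ in atTop, Real.log (n : ℝ) ^ g n ≤ (r n : ℝ)) {c : ℝ} (hc : 0 < c) :
    ∀ᶠ n : ℕ in atTop, Real.log (n : ℝ) ≤ (r n : ℝ) ^ c := by
  obtain ⟨g, hg, hr⟩ := hr
  have hlog : Tendsto (fun n : ℕ => Real.log (n : ℝ)) atTop atTop :=
    Real.tendsto_log_atTop.comp tendsto_natCast_atTop_atTop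
  filter_upwards [hr, hg.eventually_ge_atTop (1 / c), hlog.eventually_ge_atTop 1] with n h1 h2 h3
  have h4 : Real.log (n : ℝ) ^ (1 / c) ≤ r n := (Real.rpow_le_rpow_of_exponent_le h3 h2).trans h1
  calc Real.log (n : ℝ) = (Real.log (n : ℝ) ^ (1 / c)) ^ c := by
        rw [← Real.rpow_mul (by linarith), one_div_mul_cancel hc.ne', Real.rpow_one]
    _ ≤ (r n : ℝ) ^ c := Real.rpow_le_rpow (by positivity) h4 hc.le

end ModFrege

theorem theorem6p2 (p : ℕ) [Fact p.Prime]
    -- `r(n) ≥ (log n)^{ω(1)}`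
    (r : ℕ → ℕ)
    (hr : ∃ g : ℕ → ℝ, Tendsto g atTop atTop ∧
      ∀ᶠ n : ℕ in atTop, Real.log (n : ℝ) ^ g n ≤ (r n : ℝ))
    -- the polynomial systems `F n` in the variables `V n`, for `n ≥ 1`
    (V : ℕ → Type*) [∀ n, Fintype (V n)]
    (F : ∀ n, Finset (MvPolynomial (V n) (ZMod p)))
    (hdeg : ∃ D : ℕ, ∀ n ≥ 1, ∀ f ∈ F n, f.totalDegree ≤ D)
    (hsize : ∃ C : ℕ, ∀ n ≥ 1, (F n).card ≤ C * n ^ C ∧ Fintype.card (V n) ≤ C * n ^ C)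
    (hbool : ∀ n ≥ 1, ∀ x : V n, MvPolynomial.X x ^ 2 - MvPolynomial.X x ∈ F n)
    (hunsolv : ∀ n ≥ 1, ¬ ∃ a : V n → ZMod p, ∀ f ∈ F n, MvPolynomial.eval a f = 0) :
    ∀ d : ℕ, 2 ≤ d → ∃ ε_d : ℝ, 0 < ε_d ∧ ∃ n_d : ℕ, 1 ≤ n_d ∧ ∃ δ : ℝ, 0 < δ ∧
      ∀ n : ℕ, n_d ≤ n →
      ∀ Ω : Finset (ModFrege.LowDeg p (V n) (r n) → ZMod p), Ω.Nonempty →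
      ∀ ε : ℝ, 0 < ε → ε ≤ ε_d →
      (∀ T : ModFrege.SearchTree p (ModFrege.LowDeg p (V n) (r n))
            (ModFrege.ErrorLabel p (F n) (r n)),
          T.DepthLE (r n) →
          1 - (2 : ℝ) ^ (-((r n : ℝ) ^ ε)) < ModFrege.probNoError Ω T) →
      ∀ π : List (ModFrege.Sequent p (V n)),
        ModFrege.IsRefutation d (ModFrege.eqFormula '' (F n : Set (MvPolynomial (V n) (ZMod p)))) π →
        (2 : ℝ) ^ (δ * (r n : ℝ) ^ ε) ≤ (ModFrege.proofSize π : ℝ) := by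
  intro d _
  obtain ⟨D, hD⟩ := hdeg
  obtain ⟨C, hC⟩ := hsize
  set K : ℕ := 3 * d + 24 with hK
  have hK0 : (0 : ℝ) < K := by rw [hK]; positivity
  have hlog : Tendsto (fun n : ℕ => Real.log (n : ℝ)) atTop atTop :=
    Real.tendsto_log_atTop.comp tendsto_natCast_atTop_atTop
  -- The threshold serves all later demands: `2 * C + 3` for the number of variables, and the other
  -- summands to give `H ≥ 100`, `H ≥ p` and `H ≥ D`.
  obtain ⟨N, hN⟩ := eventually_atTop.1
    ((ModFrege.eventually_log_le_rpow hr (c := 1 / (2 * K)) (by positivity)).and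
      (hlog.eventually_ge_atTop (2 * C + 3 + 101 + p + D)))
  -- `K` is the exponent of `H` in the depth of the search tree, so `H` may be as large as `(r n) ^
  -- (1 / K)`. The factor `δ = 1 / 2` makes up for rounding this power down to an integer.
  refine ⟨1 / K, by positivity, max N 1, le_max_right _ _, 1 / 2, by norm_num, ?_⟩
  intro n hn Ω _ ε hε hεd hT π hπ
  have hn1 : 1 ≤ n := (le_max_right _ _).trans hn
  obtain ⟨hy, hY⟩ := hN n ((le_max_left _ _).trans hn)
  set y : ℝ := (r n : ℝ) ^ (1 / (2 * K) : ℝ) with hydef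
  have hCD : (0 : ℝ) ≤ C ∧ (0 : ℝ) ≤ D ∧ (0 : ℝ) ≤ p :=
    ⟨Nat.cast_nonneg _, Nat.cast_nonneg _, Nat.cast_nonneg _⟩
  have hyY : 2 * (C : ℝ) + 3 + 101 + p + D ≤ y := hY.trans hy
  have hy1 : 104 ≤ y := by linarith
  have hr1 : (1 : ℝ) ≤ r n := by
    rcases Nat.eq_zero_or_pos (r n) with h0 | h0
    · rw [hydef, h0, Nat.cast_zero, Real.zero_rpow (by positivity)] at hy1
      norm_num at hy1
    · exact_mod_cast h0
  have hy2 : y ^ 2 = (r n : ℝ) ^ (1 / K : ℝ) := by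
    rw [hydef, ← Real.rpow_natCast, ← Real.rpow_mul (by positivity)]
    congr 1
    push_cast
    field_simp
  have hyK : (y ^ 2) ^ K = r n := by
    rw [hy2, ← Real.rpow_natCast, ← Real.rpow_mul (by positivity), one_div_mul_cancel hK0.ne',
      Real.rpow_one]
  have hfloor : y ^ 2 - 1 ≤ (⌊y ^ 2⌋₊ : ℝ) := (Nat.sub_one_lt_floor _).le
  have hfloor' : (⌊y ^ 2⌋₊ : ℝ) ≤ y ^ 2 := Nat.floor_le (by positivity)
  have hyH : ∀ m : ℕ, (m : ℝ) ≤ y - 1 → m ≤ ⌊y ^ 2⌋₊ := fun m hm => by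
    have : (m : ℝ) ≤ (⌊y ^ 2⌋₊ : ℝ) := by nlinarith
    exact_mod_cast this
  by_contra! hsmall
  have hsize : ModFrege.proofSize π ≤ 2 ^ ⌊y ^ 2⌋₊ := by
    have h1 : (r n : ℝ) ^ ε ≤ y ^ 2 := hy2 ▸ Real.rpow_le_rpow_of_exponent_le hr1 hεd
    have h2 : (ModFrege.proofSize π : ℝ) ≤ (2 : ℝ) ^ ((⌊y ^ 2⌋₊ : ℕ) : ℝ) :=
      hsmall.le.trans (Real.rpow_le_rpow_of_exponent_le one_le_two (by nlinarith))
    rw [Real.rpow_natCast] at h2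
    exact_mod_cast h2
  obtain ⟨T, hTd, hTp⟩ := ModFrege.exists_searchTree (F := F n) (H := ⌊y ^ 2⌋₊) (d := d) (D := D)
    (e := r n) (hyH 100 (by push_cast; linarith)) (hyH p (by linarith)) (hyH D (by linarith))
    ((Nat.add_le_add_right (hC n hn1).2 1).trans
      (ModFrege.add_one_le_two_pow_floor hn1 hy (by linarith)))
    (by
      have : ((⌊y ^ 2⌋₊ ^ K : ℕ) : ℝ) ≤ r n := by
        rw [← hyK]; push_cast
        exact pow_le_pow_left₀ (Nat.cast_nonneg _) hfloor' K
      exact_mod_cast this)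
    (hD n hn1) Ω hπ hsize
  have h1 := (hT T hTd).trans_le hTp
  -- As `r n ≥ 1`, the allowed error probability is at most `1 / 2` for every `ε > 0`, however
  -- small.
  have h2 : (2 : ℝ) ^ (-((r n : ℝ) ^ ε)) ≤ 2 ^ (-1 : ℝ) :=
    Real.rpow_le_rpow_of_exponent_le one_le_two
      (neg_le_neg (Real.one_le_rpow hr1 hε.le))
  rw [Real.rpow_neg_one] at h2
  linarith
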